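/- **Proposition.** Let $n\ge 1$, let $(N^{n+1},\tilde g)$ be an oriented Riemannian manifold with a spin structure $\mathrm{Spin}N$, and let $(M^n,g)$ be an oriented hypersurface of $N$ with the induced metric, that is, an oriented manifold with an isometric immersion $f:M\to N$. Let $\nu$ be the smooth unit normal field along $f$ such that $(e_1,\dots,e_n)$ is a positively oriented frame of $M$ if and only if $(df(e_1),\dots,df(e_n),\nu)$ is one of $N$. In Clifford algebras $v\cdot v=-|v|^2$. Let $\rho_k:\mathbb{C}l_k\to\mathrm{End}_{\mathbb C}(\Sigma_k)$, for $k=n$ and $k=n+1$, be an irreducible complex representation of the complex Clifford algebra, on which, if $k$ is odd, the complex volume form $\omega_k=i^{\lfloor (k+1)/2\rfloor}e_1\cdots e_k$ acts as the identity. Let $\mathrm{Spin}M$ be the pull-back of $\mathrm{Spin}N$ under the map $\Phi:(e_1,\dots,e_n)\mapsto(df(e_1),\dots,df(e_n),\nu)$ from the oriented orthonormal frames of $M$ to those of $N$, that is, the set of the pairs $(e,p)$ with $\pi(p)=\Phi(e)$, with the action of $\mathrm{Spin}(n)\subset\mathrm{Spin}(n+1)$. Put $$\Sigma N=\mathrm{Spin}N\times_{\rho_{n+1}}\Sigma_{n+1},\qquad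 S=f^*\Sigma N=\Sigma N|_M,\qquad \Sigma M=\mathrm{Spin}M\times_{\rho_n}\Sigma_n,$$ and, if $n$ is odd, let $S^+\subset S$ be the subbundle of the spinors on which $\omega_{n+1}$ acts as the identity. Then: 1. $\mathrm{Spin}M$ is a spin structure on $M$. 2. If $n$ is even, there is an isomorphism of smooth complex vector bundles $S\to\Sigma M$, $\varphi\mapsto\varphi^*$, over $M$ such that $X\cdot\varphi^*=(df(X)\cdot\nu\cdot\varphi)^*$ for all $x\in M$, $X\in T_xM$ and $\varphi\in S_x$. 3. If $n$ is odd, then $df(X)\cdot\nu\cdot\varphi\in S^+_x$ for all $x\in M$, $X\in T_xM$ and $\varphi\in S^+_x$, and there is an isomorphism of smooth complex vector bundles $S^+\to\Sigma M$, $\varphi\mapsto\varphi^*$, over $M$ such that $X\cdot\varphi^*=(df(X)\cdot\nu\cdot\varphi)^*$ for all such $x$, $X$ and $\varphi$. -/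

import Mathlib

open scoped Manifold ContDiff TensorProduct RealInnerProductSpace
open TopologicalSpace Bundle

noncomputable section

namespace SpinGeom

/-! ### Clifford algebras, spin groups, spinor representations -/

/-- Euclidean `n`-space. -/
abbrev Eucl (n : ℕ) : Type := EuclideanSpace ℝ (Fin n)

/-- The quadratic form `v ↦ -|v|²` on `ℝⁿ`, so that `v · v = -|v|²` in the Clifford algebra. -/
def cliffordForm (n : ℕ) : QuadraticForm ℝ (Eucl n) :=
  -(LinearMap.BilinMap.toQuadraticMap (innerₗ (Eucl n)))

theorem cliffordForm_apply {n : ℕ} (v : Eucl n) : cliffordForm n v = -⟪v, v⟫ := by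
  simp [cliffordForm]

/-- The real Clifford algebra of `ℝⁿ`, with `v · v = -|v|²`. -/
abbrev Cl (n : ℕ) : Type := CliffordAlgebra (cliffordForm n)

/-- The inclusion of vectors `ℝⁿ → Cl n`. -/
abbrev vec {n : ℕ} (v : Eucl n) : Cl n := CliffordAlgebra.ι (cliffordForm n) v

/-- The complex Clifford algebra `ℂ ⊗ Cl n`. -/
abbrev CCl (n : ℕ) : Type := ℂ ⊗[ℝ] Cl n

/-- The group `Spin(n)`. -/
abbrev Spin (n : ℕ) : Type := spinGroup (cliffordForm n)

/-- The complex volume form `i^⌊(n+1)/2⌋ e₁ ⋯ eₙ`. -/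
def volumeForm (n : ℕ) : CCl n :=
  (Complex.I ^ ((n + 1) / 2)) ⊗ₜ[ℝ]
    (List.ofFn fun i : Fin n => vec (EuclideanSpace.single i (1 : ℝ))).prod

/-- A spinor representation of the complex Clifford algebra: an irreducible complex representation
(its dimension is then automatically `2^⌊n/2⌋`), on which, if `n` is odd, the complex volume form
acts as the identity. -/
structure IsSpinorRep {n : ℕ} {W : Type*} [AddCommGroup W] [Module ℂ W]
    (ρ : CCl n →ₐ[ℂ] Module.End ℂ W) : Prop where
  nontrivial : Nontrivial W
  irreducible : ∀ p : Submodule ℂ W, (∀ a : CCl n, ∀ w ∈ p, ρ a w ∈ p) → p = ⊥ ∨ p = ⊤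
  volume_eq_one : Odd n → ρ (volumeForm n) = 1

theorem vec_injective (n : ℕ) : Function.Injective (vec (n := n)) := by
  intro v w h
  have key : ∀ u : Eucl n, CliffordAlgebra.ι (cliffordForm n) u = 0 → u = 0 := by
    intro u hu
    have h1 := CliffordAlgebra.contractLeft_ι (Q := cliffordForm n) (innerₗ (Eucl n) u) u
    rw [hu, map_zero] at h1
    have h2 : (innerₗ (Eucl n) u) u = 0 := by
      have := h1.symm
      exact (map_eq_zero_iff _ (algebraMap ℝ (Cl n)).injective).1 this
    simpa using h2
  have := key (v - w) (by rw [map_sub]; exact sub_eq_zero.2 h)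
  exact sub_eq_zero.1 this

theorem exists_conj {n : ℕ} (g : Spin n) (v : Eucl n) :
    ∃ w : Eucl n, vec w = (g : Cl n) * vec v * ((g⁻¹ : Spin n) : Cl n) := by
  have h := spinGroup.conjAct_smul_ι_mem_range_ι (x := spinGroup.toUnits g) g.2 v
  obtain ⟨w, hw⟩ := h
  exact ⟨w, hw⟩

/-- The adjoint action `Ad_g v = g · v · g⁻¹` of `Spin(n)` on `ℝⁿ`. -/
def Ad {n : ℕ} (g : Spin n) (v : Eucl n) : Eucl n := (exists_conj g v).choose

theorem vec_Ad {n : ℕ} (g : Spin n) (v : Eucl n) :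
    vec (Ad g v) = (g : Cl n) * vec v * ((g⁻¹ : Spin n) : Cl n) := (exists_conj g v).choose_spec

theorem spin_inv_mul {n : ℕ} (g : Spin n) : ((g⁻¹ : Spin n) : Cl n) * (g : Cl n) = 1 :=
  spinGroup.coe_star_mul_self g

theorem spin_mul_inv {n : ℕ} (g : Spin n) : (g : Cl n) * ((g⁻¹ : Spin n) : Cl n) = 1 :=
  spinGroup.coe_mul_star_self g

theorem Ad_one {n : ℕ} (v : Eucl n) : Ad (1 : Spin n) v = v := by
  apply vec_injective
  rw [vec_Ad]; simp

theorem Ad_mul {n : ℕ} (g h : Spin n) (v : Eucl n) : Ad (g * h) v = Ad g (Ad h v) := by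
  apply vec_injective
  rw [vec_Ad, vec_Ad, vec_Ad, mul_inv_rev]
  simp only [Submonoid.coe_mul, mul_assoc]

/-- `Ad_g` as a linear automorphism of `ℝⁿ`. -/
def AdEquiv {n : ℕ} (g : Spin n) : Eucl n ≃ₗ[ℝ] Eucl n where
  toFun := Ad g
  invFun := Ad g⁻¹
  map_add' v w := by
    apply vec_injective
    simp only [vec, map_add]
    simp only [← vec.eq_1, vec_Ad]
    simp [mul_add, add_mul]
  map_smul' c v := by
    apply vec_injective
    simp only [vec, map_smul, RingHom.id_apply]
    simp only [← vec.eq_1, vec_Ad]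
    simp
  left_inv v := by rw [← Ad_mul, inv_mul_cancel, Ad_one]
  right_inv v := by rw [← Ad_mul, mul_inv_cancel, Ad_one]

@[simp] theorem AdEquiv_apply {n : ℕ} (g : Spin n) (v : Eucl n) : AdEquiv g v = Ad g v := rfl

theorem Ad_inner_self {n : ℕ} (g : Spin n) (v : Eucl n) : ⟪Ad g v, Ad g v⟫ = ⟪v, v⟫ := by
  have h1 := CliffordAlgebra.ι_sq_scalar (cliffordForm n) (Ad g v)
  have h2 := CliffordAlgebra.ι_sq_scalar (cliffordForm n) v
  have h3 : vec (Ad g v) * vec (Ad g v) = algebraMap ℝ (Cl n) (cliffordForm n v) := by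
    rw [vec_Ad]
    calc (g : Cl n) * vec v * ((g⁻¹ : Spin n) : Cl n) * ((g : Cl n) * vec v * ((g⁻¹ : Spin n) : Cl n))
        = (g : Cl n) * vec v * (((g⁻¹ : Spin n) : Cl n) * (g : Cl n)) * vec v
            * ((g⁻¹ : Spin n) : Cl n) := by simp only [mul_assoc]
      _ = (g : Cl n) * (vec v * vec v) * ((g⁻¹ : Spin n) : Cl n) := by
          rw [spin_inv_mul]; simp only [mul_assoc, mul_one]
      _ = algebraMap ℝ (Cl n) (cliffordForm n v) := by
          rw [h2, ← Algebra.commutes, mul_assoc, spin_mul_inv, mul_one]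
  have h4 := (algebraMap ℝ (Cl n)).injective (h1.symm.trans h3)
  rw [cliffordForm_apply, cliffordForm_apply] at h4
  exact neg_injective h4

theorem Ad_inner {n : ℕ} (g : Spin n) (v w : Eucl n) : ⟪Ad g v, Ad g w⟫ = ⟪v, w⟫ := by
  have h := Ad_inner_self g (v + w)
  have e : Ad g (v + w) = Ad g v + Ad g w := (AdEquiv g).map_add v w
  rw [e, real_inner_add_add_self, real_inner_add_add_self, Ad_inner_self, Ad_inner_self] at h
  linarith

/-- The inclusion `ℝⁿ → ℝⁿ⁺¹`, `v ↦ (v, 0)`. -/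
def incl (n : ℕ) : Eucl n →ₗ[ℝ] Eucl (n + 1) where
  toFun v := WithLp.toLp 2 (Fin.snoc (α := fun _ => ℝ) v.ofLp 0)
  map_add' v w := by
    ext i
    refine Fin.lastCases ?_ (fun j => ?_) i <;> simp
  map_smul' c v := by
    ext i
    refine Fin.lastCases ?_ (fun j => ?_) i <;> simp

/-- The last vector of the canonical basis of `ℝⁿ⁺¹`. -/
def lastVec (n : ℕ) : Eucl (n + 1) := EuclideanSpace.single (Fin.last n) (1 : ℝ)

theorem inner_incl {n : ℕ} (v w : Eucl n) : ⟪incl n v, incl n w⟫ = ⟪v, w⟫ := by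
  simp [incl, PiLp.inner_apply, Fin.sum_univ_castSucc]

theorem inner_incl_lastVec {n : ℕ} (v : Eucl n) : ⟪incl n v, lastVec n⟫ = 0 := by
  simp [incl, lastVec, PiLp.inner_apply]

/-- The inclusion `ℝⁿ → ℝⁿ⁺¹` as an isometry of quadratic spaces. -/
def inclIsometry (n : ℕ) : cliffordForm n →qᵢ cliffordForm (n + 1) where
  toLinearMap := incl n
  map_app' v := by
    change cliffordForm (n + 1) (incl n v) = _
    rw [cliffordForm_apply, cliffordForm_apply, inner_incl]

/-- The inclusion `Cl n → Cl (n+1)`. -/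
def clIncl (n : ℕ) : Cl n →ₐ[ℝ] Cl (n + 1) := CliffordAlgebra.map (inclIsometry n)

theorem clIncl_vec {n : ℕ} (v : Eucl n) : clIncl n (vec v) = vec (incl n v) :=
  CliffordAlgebra.map_apply_ι _ _

theorem clIncl_involute {n : ℕ} (x : Cl n) :
    clIncl n (CliffordAlgebra.involute x) = CliffordAlgebra.involute (clIncl n x) := by
  have : (clIncl n).comp CliffordAlgebra.involute
      = (CliffordAlgebra.involute).comp (clIncl n) := by
    apply CliffordAlgebra.hom_ext
    ext v
    simp only [AlgHom.comp_toLinearMap, LinearMap.coe_comp, Function.comp_apply,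
      AlgHom.toLinearMap_apply, CliffordAlgebra.involute_ι, map_neg]
    rw [← vec.eq_1, clIncl_vec]
    simp
  exact DFunLike.congr_fun this x

theorem clIncl_star {n : ℕ} (x : Cl n) : clIncl n (star x) = star (clIncl n x) := by
  induction x using CliffordAlgebra.induction with
  | algebraMap r => simp
  | ι v =>
    rw [CliffordAlgebra.star_ι, map_neg, ← vec.eq_1, clIncl_vec, CliffordAlgebra.star_ι]
  | mul a b ha hb => rw [star_mul, map_mul, map_mul, star_mul, ha, hb]
  | add a b ha hb => rw [star_add, map_add, map_add, star_add, ha, hb]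

theorem clIncl_mem_even {n : ℕ} {x : Cl n} (hx : x ∈ CliffordAlgebra.even (cliffordForm n)) :
    clIncl n x ∈ CliffordAlgebra.even (cliffordForm (n + 1)) := by
  have hx' : x ∈ CliffordAlgebra.evenOdd (cliffordForm n) 0 := hx
  change clIncl n x ∈ CliffordAlgebra.evenOdd (cliffordForm (n + 1)) 0
  clear hx
  induction x, hx' using CliffordAlgebra.even_induction with
  | algebraMap r =>
    rw [AlgHom.commutes]
    exact SetLike.algebraMap_mem_graded _ r
  | add x y hx hy ihx ihy =>
    rw [map_add]; exact add_mem ihx ihy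
  | ι_mul_ι_mul v w x hx ih =>
    rw [map_mul, map_mul, ← vec.eq_1, ← vec.eq_1, clIncl_vec, clIncl_vec]
    have h1 := CliffordAlgebra.ι_mul_ι_mem_evenOdd_zero (cliffordForm (n + 1)) (incl n v) (incl n w)
    have h2 := SetLike.mul_mem_graded h1 ih
    simpa using h2

theorem clIncl_mem_spin {n : ℕ} {x : Cl n} (hx : x ∈ spinGroup (cliffordForm n)) :
    clIncl n x ∈ spinGroup (cliffordForm (n + 1)) := by
  obtain ⟨⟨⟨u, hu, rfl⟩, hx2⟩, hx3⟩ := hx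
  refine ⟨⟨⟨Units.map (clIncl n : Cl n →* Cl (n + 1)) u, ?_, rfl⟩, ?_⟩, clIncl_mem_even hx3⟩
  · have hle : lipschitzGroup (cliffordForm n) ≤
        (lipschitzGroup (cliffordForm (n + 1))).comap
          (Units.map (clIncl n : Cl n →* Cl (n + 1))) := by
      refine (Subgroup.closure_le _).2 ?_
      rintro y ⟨v, hv⟩
      refine Subgroup.subset_closure ⟨incl n v, ?_⟩
      rw [← vec.eq_1, ← clIncl_vec]
      exact congrArg (clIncl n) hv
    exact hle hu
  · have hx2 := Unitary.mem_iff.1 (SetLike.mem_coe.1 hx2)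
    refine SetLike.mem_coe.2 (Unitary.mem_iff.2 ?_)
    constructor
    · rw [← clIncl_star, ← map_mul, hx2.1, map_one]
    · rw [← clIncl_star, ← map_mul, hx2.2, map_one]

/-- The standard inclusion `Spin(n) → Spin(n+1)`. -/
def spinIncl (n : ℕ) : Spin n →* Spin (n + 1) where
  toFun g := ⟨clIncl n g, clIncl_mem_spin g.2⟩
  map_one' := Subtype.ext (map_one _)
  map_mul' _ _ := Subtype.ext (map_mul _ _ _)

theorem Ad_spinIncl_incl {n : ℕ} (g : Spin n) (v : Eucl n) :
    Ad (spinIncl n g) (incl n v) = incl n (Ad g v) := by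
  apply vec_injective
  rw [vec_Ad, ← clIncl_vec, ← clIncl_vec, vec_Ad, map_mul, map_mul, ← map_inv]
  rfl

theorem clIncl_involute_comm {n : ℕ} (x : Cl n) :
    vec (lastVec n) * clIncl n x = clIncl n (CliffordAlgebra.involute x) * vec (lastVec n) := by
  induction x using CliffordAlgebra.induction with
  | algebraMap r => simp [Algebra.commutes]
  | ι v =>
    rw [CliffordAlgebra.involute_ι, map_neg, ← vec.eq_1, clIncl_vec, neg_mul]
    have h := CliffordAlgebra.ι_mul_ι_add_swap (Q := cliffordForm (n + 1)) (lastVec n) (incl n v)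
    have h0 : QuadraticMap.polar (cliffordForm (n + 1)) (lastVec n) (incl n v) = 0 := by
      rw [QuadraticMap.polar, cliffordForm_apply, cliffordForm_apply, cliffordForm_apply,
        real_inner_add_add_self, real_inner_comm (incl n v) (lastVec n), inner_incl_lastVec]
      ring
    rw [h0, map_zero] at h
    exact eq_neg_of_add_eq_zero_left h
  | mul a b ha hb => rw [map_mul, ← mul_assoc, ha, mul_assoc, hb, map_mul, map_mul, mul_assoc]
  | add a b ha hb => rw [map_add, mul_add, ha, hb, map_add, map_add, add_mul]

theorem Ad_spinIncl_lastVec {n : ℕ} (g : Spin n) : Ad (spinIncl n g) (lastVec n) = lastVec n := by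
  apply vec_injective
  have h := clIncl_involute_comm (g : Cl n)
  rw [spinGroup.involute_eq g.2] at h
  have h' : (spinIncl n g : Cl (n + 1)) * vec (lastVec n) = vec (lastVec n) * spinIncl n g := h.symm
  rw [vec_Ad, h', mul_assoc, spin_mul_inv, mul_one]

/-! ### Oriented Riemannian manifolds and their oriented orthonormal frames -/

section Manifold

/-- The orientation of a vector space `V` for which the image of the canonical basis of `ℝⁿ` under
`e : ℝⁿ ≃ V` is positively oriented. -/
def frameOrientation {n : ℕ} {V : Type*} [AddCommGroup V] [Module ℝ V] (e : Eucl n ≃ₗ[ℝ] V) :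
    Orientation ℝ V (Fin n) :=
  Orientation.map (Fin n) e (EuclideanSpace.basisFun (Fin n) ℝ).toBasis.orientation

/-- A map from a subset `U` of a manifold to a finite-dimensional real vector space is smooth
(all its coordinates are smooth). -/
def SmoothOn {n : ℕ} {M : Type*} [TopologicalSpace M] [ChartedSpace (Eucl n) M]
    {V : Type*} [AddCommGroup V] [Module ℝ V] (F : M → V) (U : Set M) : Prop :=
  ∀ ℓ : V →ₗ[ℝ] ℝ, ContMDiffOn (𝓡 n) 𝓘(ℝ, ℝ) ∞ (fun x => ℓ (F x)) U

/-- A smooth oriented Riemannian structure on an `n`-manifold. -/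
structure OrientedRiemannian (n : ℕ) (M : Type*) [TopologicalSpace M] [ChartedSpace (Eucl n) M]
    [IsManifold (𝓡 n) ∞ M] where
  metric : ContMDiffRiemannianMetric (𝓡 n) ∞ (Eucl n) (fun x : M => TangentSpace (𝓡 n) x)
  orientation : ∀ x : M, Orientation ℝ (TangentSpace (𝓡 n) x) (Fin n)
  /-- Near every point there is a positively oriented smooth local frame. -/
  orientation_smooth : ∀ x : M, ∃ U : Opens M, x ∈ U ∧
    ∃ e : ∀ y : M, Eucl n ≃ₗ[ℝ] TangentSpace (𝓡 n) y,
      (∀ v : Eucl n, ContMDiffOn (𝓡 n) (𝓡 n).tangent ∞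
        (fun y => (⟨y, e y v⟩ : TangentBundle (𝓡 n) M)) U) ∧
      ∀ y ∈ U, frameOrientation (e y) = orientation y

variable {n : ℕ} {M : Type*} [TopologicalSpace M] [ChartedSpace (Eucl n) M]
  [IsManifold (𝓡 n) ∞ M]

/-- The fibre at `x` of the bundle `SO M` of oriented orthonormal frames. The frame
`(e₁, …, eₙ)` is encoded as the linear isomorphism `ℝⁿ → T_x M` with `v ↦ ∑ vⁱ eᵢ`. -/
structure SOFrame (G : OrientedRiemannian n M) (x : M) where
  toEquiv : Eucl n ≃ₗ[ℝ] TangentSpace (𝓡 n) x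
  orthonormal : ∀ v w, G.metric.inner x (toEquiv v) (toEquiv w) = ⟪v, w⟫
  oriented : frameOrientation toEquiv = G.orientation x

theorem SOFrame.ext' {G : OrientedRiemannian n M} {x : M} {e e' : SOFrame G x}
    (h : ∀ v, e.toEquiv v = e'.toEquiv v) : e = e' := by
  cases e; cases e'
  congr
  exact LinearEquiv.ext h

/-! ### Spin structures -/

/-- The data of a bundle of spin frames over an oriented Riemannian manifold: fibres with a right
action of `Spin(n)`, an equivariant projection to the oriented orthonormal frames, and an
atlas of local sections. It is a spin structure if it satisfies `IsSpinStructure` below. -/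
structure SpinFrames (G : OrientedRiemannian n M) where
  Fiber : M → Type*
  act : ∀ {x : M}, Fiber x → Spin n → Fiber x
  act_one : ∀ {x : M} (p : Fiber x), act p 1 = p
  act_mul : ∀ {x : M} (p : Fiber x) (g h : Spin n), act p (g * h) = act (act p g) h
  proj : ∀ {x : M}, Fiber x → SOFrame G x
  /-- `π(p g) = π(p) ∘ Ad_g`. -/
  proj_act : ∀ {x : M} (p : Fiber x) (g : Spin n) (v : Eucl n),
    (proj (act p g)).toEquiv v = (proj p).toEquiv (Ad g v)
  /-- Smooth local sections: `(U, s)` stands for the section `s` restricted to `U`. -/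
  atlas : Set (Opens M × (∀ x : M, Fiber x))

namespace SpinFrames

variable {G : OrientedRiemannian n M}

/-- For a map `f : K → M`, the local lift `s` of `f` on `U ⊆ K` to the spin frames is smooth: with
respect to the sections `t` of the atlas, `s = (t ∘ f) γ` with `γ` a smooth
map into `Spin(n) ⊂ Cl n`. -/
def SmoothLift (P : SpinFrames G) {k : ℕ} {K : Type*} [TopologicalSpace K]
    [ChartedSpace (Eucl k) K] (f : K → M) (U : Set K) (s : ∀ y : K, P.Fiber (f y)) : Prop :=
  ∀ c ∈ P.atlas, ∃ γ : K → Spin n,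
    (∀ y ∈ U ∩ f ⁻¹' (c.1 : Set M), s y = P.act (c.2 (f y)) (γ y)) ∧
    SmoothOn (n := k) (fun y => (γ y : Cl n)) (U ∩ f ⁻¹' (c.1 : Set M))

/-- `P` is a spin structure: a smooth principal `Spin(n)`-bundle (free and fibrewise transitive
action, smooth local sections around every point with smooth transition maps) such that the
equivariant projection to the oriented orthonormal frame bundle is smooth. -/
structure IsSpinStructure (P : SpinFrames G) : Prop where
  free : ∀ {x : M} (p : P.Fiber x) (g : Spin n), P.act p g = p → g = 1
  transitive : ∀ {x : M} (p q : P.Fiber x), ∃ g : Spin n, P.act p g = q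
  covers : ∀ x : M, ∃ c ∈ P.atlas, x ∈ c.1
  compatible : ∀ c ∈ P.atlas, P.SmoothLift (k := n) (fun x : M => x) c.1 c.2
  proj_smooth : ∀ c ∈ P.atlas, ∀ v : Eucl n, ContMDiffOn (𝓡 n) (𝓡 n).tangent ∞
    (fun y => (⟨y, (P.proj (c.2 y)).toEquiv v⟩ : TangentBundle (𝓡 n) M)) c.1

variable {W : Type*} [AddCommGroup W] [Module ℂ W]

/-- The fibre at `x` of the spinor bundle `P ×_ρ W`, realized as the space of the equivariant maps
`φ : P_x → W`, `φ(p g) = ρ(g⁻¹) φ(p)`; the class `[p, σ]` is the equivariant map with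
value `σ` at `p`. -/
def Spinor (P : SpinFrames G) (ρ : CCl n →ₐ[ℂ] Module.End ℂ W) (x : M) :
    Submodule ℂ (P.Fiber x → W) where
  carrier := {φ | ∀ (p : P.Fiber x) (g : Spin n),
    φ (P.act p g) = ρ (1 ⊗ₜ[ℝ] ((g⁻¹ : Spin n) : Cl n)) (φ p)}
  add_mem' hφ hψ p g := by simp [hφ p g, hψ p g]
  zero_mem' p g := by simp
  smul_mem' c φ hφ p g := by simp [hφ p g]

/-- Clifford multiplication of spinors by a tangent vector: `X · [p, σ] = [p, ρ(v) σ]`, where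
`v ∈ ℝⁿ` is the vector of the coordinates of `X` in the frame `π(p)`. -/
def cliffordMul (P : SpinFrames G) (ρ : CCl n →ₐ[ℂ] Module.End ℂ W) {x : M}
    (X : TangentSpace (𝓡 n) x) : P.Spinor ρ x →ₗ[ℂ] P.Spinor ρ x where
  toFun φ := ⟨fun p => ρ (1 ⊗ₜ[ℝ] vec ((P.proj p).toEquiv.symm X)) (φ.1 p), by
    intro p g
    have hX : (P.proj p).toEquiv.symm X = Ad g ((P.proj (P.act p g)).toEquiv.symm X) := by
      apply (P.proj p).toEquiv.injective
      rw [← P.proj_act, LinearEquiv.apply_symm_apply, LinearEquiv.apply_symm_apply]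
    beta_reduce
    rw [φ.2 p g, hX, vec_Ad, ← Module.End.mul_apply, ← Module.End.mul_apply, ← map_mul, ← map_mul,
      Algebra.TensorProduct.tmul_mul_tmul, Algebra.TensorProduct.tmul_mul_tmul]
    rw [← mul_assoc, ← mul_assoc, spin_inv_mul]
    simp only [one_mul]⟩
  map_add' φ ψ := by
    ext p
    simp
  map_smul' c φ := by
    ext p
    simp

/-- The positive spinors: those with values in the `+1`-eigenspace of the complex volume form. -/
def PosSpinor (P : SpinFrames G) (ρ : CCl n →ₐ[ℂ] Module.End ℂ W) (x : M) :
    Submodule ℂ (P.Spinor ρ x) where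
  carrier := {φ | ∀ p : P.Fiber x, ρ (volumeForm n) (φ.1 p) = φ.1 p}
  add_mem' hφ hψ p := by
    have := congrArg₂ (· + ·) (hφ p) (hψ p)
    simpa using this
  zero_mem' p := by simp
  smul_mem' c φ hφ p := by
    have := congrArg (c • ·) (hφ p)
    simpa using this

/-- A section `φ` of the spinor bundle along a map `f : K → M` (that is, of the pulled back bundle)
is smooth on `U ⊆ K`: locally `φ = [s, σ]` with a smooth local spin frame `s` and a
smooth `σ`. -/
def SmoothSpinor (P : SpinFrames G) (ρ : CCl n →ₐ[ℂ] Module.End ℂ W) {k : ℕ} {K : Type*}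
    [TopologicalSpace K] [ChartedSpace (Eucl k) K] (f : K → M) (U : Set K)
    (φ : ∀ y : K, P.Spinor ρ (f y)) : Prop :=
  ∀ c ∈ P.atlas, SmoothOn (n := k) (fun y => (φ y).1 (c.2 (f y))) (U ∩ f ⁻¹' (c.1 : Set M))

end SpinFrames

/-! ### Oriented hypersurfaces and the induced spin structure -/

/-- An oriented hypersurface: an isometric immersion `f` of an oriented Riemannian `n`-manifold `M`
into an oriented Riemannian `(n+1)`-manifold `N`, with the unit normal field `ν` along `f` for which
`(e₁, …, eₙ)` is positively oriented on `M` if and only if `(e₁, …, eₙ, ν)` is so on `N`. -/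
structure OrientedHypersurface {N : Type*} [TopologicalSpace N] [ChartedSpace (Eucl (n + 1)) N]
    [IsManifold (𝓡 (n + 1)) ∞ N] (GM : OrientedRiemannian n M)
    (GN : OrientedRiemannian (n + 1) N) where
  f : M → N
  smooth : ContMDiff (𝓡 n) (𝓡 (n + 1)) ∞ f
  isometric : ∀ (x : M) (X Y : TangentSpace (𝓡 n) x),
    GN.metric.inner (f x) (mfderiv (𝓡 n) (𝓡 (n + 1)) f x X) (mfderiv (𝓡 n) (𝓡 (n + 1)) f x Y)
      = GM.metric.inner x X Y
  ν : ∀ x : M, TangentSpace (𝓡 (n + 1)) (f x)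
  ν_smooth : ContMDiff (𝓡 n) (𝓡 (n + 1)).tangent ∞
    (fun x => (⟨f x, ν x⟩ : TangentBundle (𝓡 (n + 1)) N))
  ν_unit : ∀ x : M, GN.metric.inner (f x) (ν x) (ν x) = 1
  ν_normal : ∀ (x : M) (X : TangentSpace (𝓡 n) x),
    GN.metric.inner (f x) (mfderiv (𝓡 n) (𝓡 (n + 1)) f x X) (ν x) = 0
  oriented : ∀ (x : M) (e : Eucl n ≃ₗ[ℝ] TangentSpace (𝓡 n) x)
    (e' : Eucl (n + 1) ≃ₗ[ℝ] TangentSpace (𝓡 (n + 1)) (f x)),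
    (∀ v, e' (incl n v) = mfderiv (𝓡 n) (𝓡 (n + 1)) f x (e v)) → e' (lastVec n) = ν x →
    (frameOrientation e = GM.orientation x ↔ frameOrientation e' = GN.orientation (f x))

namespace OrientedHypersurface

variable {N : Type*} [TopologicalSpace N] [ChartedSpace (Eucl (n + 1)) N]
  [IsManifold (𝓡 (n + 1)) ∞ N] {GM : OrientedRiemannian n M} {GN : OrientedRiemannian (n + 1) N}

/-- The image `df(X)` of a tangent vector of the hypersurface. -/
def push (H : OrientedHypersurface GM GN) {x : M} (X : TangentSpace (𝓡 n) x) :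
    TangentSpace (𝓡 (n + 1)) (H.f x) := mfderiv (𝓡 n) (𝓡 (n + 1)) H.f x X

/-- The frame `e'` of `N` is `Φ(e) = (e₁, …, eₙ, ν)`. -/
def IsAdapted (H : OrientedHypersurface GM GN) {x : M} (e : SOFrame GM x)
    (e' : SOFrame GN (H.f x)) : Prop :=
  (∀ v : Eucl n, e'.toEquiv (incl n v) = H.push (e.toEquiv v)) ∧ e'.toEquiv (lastVec n) = H.ν x

/-- The pull-back under `Φ : SO M → SO N|_M` of a spin structure of `N`: its elements over `x ∈ M`
are the pairs `(e, p)` of `e ∈ SO M` and `p ∈ Spin N` over `f(x)` with `π(p) = Φ(e)`; `Spin(n)` acts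
by `(e, p) g = (e ∘ Ad_g, p g)`, and a section is smooth if both its components are. -/
def inducedSpin (H : OrientedHypersurface GM GN) (P : SpinFrames GN) : SpinFrames GM where
  Fiber x := {q : SOFrame GM x × P.Fiber (H.f x) // H.IsAdapted q.1 (P.proj q.2)}
  act {x} q g :=
    ⟨(⟨(AdEquiv g).trans q.1.1.toEquiv, fun v w => by
        simp only [LinearEquiv.trans_apply, AdEquiv_apply]
        rw [q.1.1.orthonormal, Ad_inner],
      by
        refine (H.oriented x _ (P.proj (P.act q.1.2 (spinIncl n g))).toEquiv ?_ ?_).2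
          (P.proj _).oriented
        · intro v
          rw [P.proj_act, Ad_spinIncl_incl]
          exact q.2.1 (Ad g v)
        · rw [P.proj_act, Ad_spinIncl_lastVec]
          exact q.2.2⟩,
      P.act q.1.2 (spinIncl n g)), by
        constructor
        · intro v
          rw [P.proj_act, Ad_spinIncl_incl]
          exact q.2.1 (Ad g v)
        · rw [P.proj_act, Ad_spinIncl_lastVec]
          exact q.2.2⟩
  act_one {x} q := by
    apply Subtype.ext
    refine Prod.ext (SOFrame.ext' fun v => ?_) ?_
    · simp [Ad_one]
    · simp [P.act_one]
  act_mul {x} q g h := by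
    apply Subtype.ext
    refine Prod.ext (SOFrame.ext' fun v => ?_) ?_
    · simp [Ad_mul]
    · simp [P.act_mul]
  proj q := q.1.1
  proj_act q g v := rfl
  atlas := {c | (∀ v : Eucl n, ContMDiffOn (𝓡 n) (𝓡 n).tangent ∞
        (fun y => (⟨y, (c.2 y).1.1.toEquiv v⟩ : TangentBundle (𝓡 n) M)) c.1) ∧
      P.SmoothLift (k := n) H.f c.1 (fun y => (c.2 y).1.2)}

end OrientedHypersurface

end Manifold

end SpinGeom

end

open SpinGeom

noncomputable section

namespace SpinGeom

/-! ### The structure of the real Clifford algebras -/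

/-! The algebraic core is the homomorphism `clEven` from `Cl n` to `Cl (n+1)`, `v ↦ v · eₙ₊₁`. The
Clifford relation holds because `(v eₙ₊₁)(w eₙ₊₁) = v w` for `v, w ⟂ eₙ₊₁`. The same identity shows
that `clEven` agrees with the standard inclusion on even elements, in particular on `Spin(n)`
(`clEven_eq_clIncl`). So `Σₙ₊₁` becomes a `Cl n`-module whose `Spin(n)`-action is the restricted
one. For `n` even this module is irreducible; for `n` odd its `ωₙ₊₁ = 1` eigenspace is, and `ωₙ`
acts there as `ωₙ₊₁ = 1`. Uniqueness of the spinor representation (`IsSpinorRep.exists_equiv`) then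
gives an isomorphism `T` onto `Σₙ`.

At a point `(e, p)` of the induced bundle the frame `π(p)` sends `eₙ₊₁` to `ν` and `(v, 0)` to `df(e
v)`. Hence `df(X) · ν ·` acts on values at `p` as `clEven` of the coordinates of `X`
(`cliffordMul_push_ν_apply`), and `φ* = T ∘ φ ∘ pr₂` is equivariant and has the required Clifford
multiplication.

That `SpinM` is a spin structure rests on two facts, for `n ≥ 1`: `Spin(n+1)` acts transitively on
the unit sphere (`exists_Ad_lastVec_eq`), and the stabilizer of `eₙ₊₁` is `Spin(n)`
(`exists_spinIncl_eq`). The first makes the fibres nonempty, and its smooth local form `rotor` turns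
a local section of `SpinN` into one adapted to `ν`; the second gives transitivity on the fibres. -/

theorem eq_zero_of_neg_eq_self {V : Type*} [AddCommGroup V] [Module ℝ V] {x : V} (h : -x = x) :
    x = 0 := by
  have h2 : (2 : ℝ) • x = 0 := by rw [two_smul]; nth_rw 1 [← h]; exact neg_add_cancel x
  exact (smul_eq_zero.1 h2).resolve_left two_ne_zero

theorem vec_add {n : ℕ} (v w : Eucl n) : vec (v + w) = vec v + vec w := map_add _ v w

theorem vec_sub {n : ℕ} (v w : Eucl n) : vec (v - w) = vec v - vec w := map_sub _ v w

theorem vec_neg {n : ℕ} (v : Eucl n) : vec (-v) = -vec v := map_neg _ v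

theorem vec_smul {n : ℕ} (c : ℝ) (v : Eucl n) : vec (c • v) = c • vec v := map_smul _ c v

theorem vec_mul_self {n : ℕ} (v : Eucl n) : vec v * vec v = algebraMap ℝ (Cl n) (-⟪v, v⟫) := by
  rw [CliffordAlgebra.ι_sq_scalar, cliffordForm_apply]

theorem vec_mul_self_of_norm_eq_one {n : ℕ} {v : Eucl n} (hv : ‖v‖ = 1) : vec v * vec v = -1 := by
  rw [vec_mul_self, real_inner_self_eq_norm_sq, hv]; simp

theorem vec_mul_vec_add_swap {n : ℕ} (v w : Eucl n) :
    vec v * vec w + vec w * vec v = algebraMap ℝ (Cl n) (-(2 * ⟪v, w⟫)) := by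
  rw [CliffordAlgebra.ι_mul_ι_add_swap, QuadraticMap.polar, cliffordForm_apply, cliffordForm_apply,
    cliffordForm_apply, real_inner_add_add_self]
  congr 1
  ring

theorem norm_lastVec (n : ℕ) : ‖lastVec n‖ = 1 := by simp [lastVec]

theorem vec_lastVec_sq (n : ℕ) : vec (lastVec n) * vec (lastVec n) = -1 :=
  vec_mul_self_of_norm_eq_one (norm_lastVec n)

/-- The projection `ℝⁿ⁺¹ → ℝⁿ` that forgets the last coordinate. -/
def dropLast (n : ℕ) : Eucl (n + 1) →ₗ[ℝ] Eucl n where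
  toFun v := WithLp.toLp 2 (fun i => v i.castSucc)
  map_add' v w := by ext i; simp
  map_smul' c v := by ext i; simp

theorem incl_dropLast_add {n : ℕ} (v : Eucl (n + 1)) :
    incl n (dropLast n v) + v (Fin.last n) • lastVec n = v := by
  ext i
  refine Fin.lastCases ?_ (fun j => ?_) i <;> simp [incl, dropLast, lastVec]

@[simp] theorem dropLast_incl {n : ℕ} (v : Eucl n) : dropLast n (incl n v) = v := by
  ext i; simp [incl, dropLast]

theorem dropLast_lastVec (n : ℕ) : dropLast n (lastVec n) = 0 := by
  ext i; simp [dropLast, lastVec]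

theorem inner_dropLast_add {n : ℕ} (v : Eucl (n + 1)) :
    ⟪dropLast n v, dropLast n v⟫ + v (Fin.last n) * v (Fin.last n) = ⟪v, v⟫ := by
  rw [PiLp.inner_apply, PiLp.inner_apply, Fin.sum_univ_castSucc]
  simp [dropLast, pow_two]

theorem incl_dropLast_of_inner_eq_zero {n : ℕ} {v : Eucl (n + 1)} (hv : ⟪v, lastVec n⟫ = 0) :
    incl n (dropLast n v) = v := by
  have h : v (Fin.last n) = 0 := by simpa [lastVec, PiLp.inner_apply] using hv
  have := incl_dropLast_add v
  rwa [h, zero_smul, add_zero] at this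

/-- The off-diagonal entries cancel because scalars are central, and the diagonal ones are `x² -
t²`. With `x = v'` and `t` the last coordinate of `v = (v', t)` this is the Clifford relation for
`v`. -/
theorem mul_self_matrix_of_sq_eq {A : Type*} [Ring A] [Algebra ℝ A] {x : A} {r t : ℝ}
    (h : x * x = algebraMap ℝ A (r + t * t)) :
    (!![x, -algebraMap ℝ A t; algebraMap ℝ A t, -x] : Matrix (Fin 2) (Fin 2) A)
      * !![x, -algebraMap ℝ A t; algebraMap ℝ A t, -x] = algebraMap ℝ _ r := by
  have hc := Algebra.commutes t x
  rw [map_add, map_mul] at h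
  ext i j
  fin_cases i <;> fin_cases j <;>
    simp [Matrix.mul_apply, Fin.sum_univ_two, Matrix.algebraMap_matrix_apply, h, hc]

/-- The action of the vectors in the representation `clMatrix`. -/
def clMatrixVec (n : ℕ) : Eucl (n + 1) →ₗ[ℝ] Matrix (Fin 2) (Fin 2) (Cl n) where
  toFun v := !![vec (dropLast n v), -algebraMap ℝ (Cl n) (v (Fin.last n));
          algebraMap ℝ (Cl n) (v (Fin.last n)), -vec (dropLast n v)]
  map_add' v w := by
    rw [map_add, vec_add, PiLp.add_apply, map_add, neg_add, neg_add]
    ext i j; fin_cases i <;> fin_cases j <;> rfl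
  map_smul' c v := by
    rw [map_smul, vec_smul, PiLp.smul_apply, smul_eq_mul, map_mul, ← Algebra.smul_def, ← smul_neg,
      ← smul_neg]
    ext i j; fin_cases i <;> fin_cases j <;> rfl

/-- The representation of `Cl (n+1)` by `2 × 2` matrices over `Cl n`. -/
def clMatrix (n : ℕ) : Cl (n + 1) →ₐ[ℝ] Matrix (Fin 2) (Fin 2) (Cl n) :=
  CliffordAlgebra.lift (cliffordForm (n + 1)) ⟨clMatrixVec n, fun v => by
    apply mul_self_matrix_of_sq_eq
    rw [vec_mul_self, cliffordForm_apply, ← inner_dropLast_add v]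
    congr 1; ring⟩

theorem clMatrix_vec {n : ℕ} (v : Eucl (n + 1)) :
    clMatrix n (vec v) = !![vec (dropLast n v), -algebraMap ℝ (Cl n) (v (Fin.last n));
          algebraMap ℝ (Cl n) (v (Fin.last n)), -vec (dropLast n v)] :=
  CliffordAlgebra.lift_ι_apply _ _ _

theorem clMatrix_clIncl {n : ℕ} (x : Cl n) :
    clMatrix n (clIncl n x) = !![x, 0; 0, CliffordAlgebra.involute x] := by
  induction x using CliffordAlgebra.induction with
  | algebraMap r =>
    ext i j
    fin_cases i <;> fin_cases j <;> simp [Matrix.algebraMap_matrix_apply]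
  | ι v =>
    have h : incl n v (Fin.last n) = 0 := by simp [incl]
    rw [← vec.eq_1, clIncl_vec, clMatrix_vec, dropLast_incl, h]
    simp
  | mul a b ha hb =>
    rw [map_mul, map_mul, ha, hb]
    ext i j
    fin_cases i <;> fin_cases j <;> simp [Matrix.mul_apply, Fin.sum_univ_two]
  | add a b ha hb =>
    rw [map_add, map_add, ha, hb]
    ext i j
    fin_cases i <;> fin_cases j <;> simp

theorem clMatrix_lastVec (n : ℕ) : clMatrix n (vec (lastVec n)) = !![0, -1; 1, 0] := by
  rw [clMatrix_vec, dropLast_lastVec]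
  simp [lastVec]

/-- `clMatrix` sends `a + b eₙ₊₁` to a matrix with first row `(a, -b)`, from which both coefficients
can be read off. -/
theorem clIncl_add_mul_lastVec_injective {n : ℕ} {a b c d : Cl n}
    (h : clIncl n a + clIncl n b * vec (lastVec n) = clIncl n c + clIncl n d * vec (lastVec n)) :
    a = c ∧ b = d := by
  have h1 := congrArg (clMatrix n) h
  simp only [map_add, map_mul, clMatrix_clIncl, clMatrix_lastVec] at h1
  constructor
  · simpa [Matrix.mul_apply, Fin.sum_univ_two] using congrFun (congrFun h1 0) 0
  · simpa [Matrix.mul_apply, Fin.sum_univ_two] using congrFun (congrFun h1 0) 1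

theorem clIncl_injective (n : ℕ) : Function.Injective (clIncl n) := by
  intro a b h
  refine (clIncl_add_mul_lastVec_injective (b := 0) (d := 0) ?_).1
  rw [h]

/-- Elements of this form are closed under products: `eₙ₊₁` passes an element of `Cl n` at the price
of the grade involution, and `eₙ₊₁² = -1`. -/
theorem exists_clIncl_add_mul_lastVec {n : ℕ} (x : Cl (n + 1)) :
    ∃ a b : Cl n, x = clIncl n a + clIncl n b * vec (lastVec n) := by
  induction x using CliffordAlgebra.induction with
  | algebraMap r => exact ⟨algebraMap ℝ _ r, 0, by simp⟩
  | ι v =>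
    refine ⟨vec (dropLast n v), algebraMap ℝ _ (v (Fin.last n)), ?_⟩
    rw [clIncl_vec, AlgHom.commutes, ← Algebra.smul_def]
    conv_lhs => rw [← incl_dropLast_add v]
    simp
  | mul x y hx hy =>
    obtain ⟨a, b, rfl⟩ := hx
    obtain ⟨c, d, rfl⟩ := hy
    refine ⟨a * c - b * CliffordAlgebra.involute d, a * d + b * CliffordAlgebra.involute c, ?_⟩
    have h1 := clIncl_involute_comm c
    have h2 := clIncl_involute_comm d
    have h3 := vec_lastVec_sq n
    simp only [map_sub, map_add, map_mul, add_mul, mul_add, mul_assoc]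
    rw [h1, ← mul_assoc (vec (lastVec n)) (clIncl n d), h2, mul_assoc _ _ (vec (lastVec n)), h3]
    simp only [mul_neg, mul_one]
    abel
  | add x y hx hy =>
    obtain ⟨a, b, rfl⟩ := hx
    obtain ⟨c, d, rfl⟩ := hy
    refine ⟨a + c, b + d, ?_⟩
    simp only [map_add, add_mul]
    abel

theorem exists_algebraMap_eq_of_cl_zero (x : Cl 0) : ∃ r : ℝ, x = algebraMap ℝ (Cl 0) r := by
  induction x using CliffordAlgebra.induction with
  | algebraMap r => exact ⟨r, rfl⟩
  | ι v => exact ⟨0, by rw [Subsingleton.elim v 0]; simp⟩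
  | mul x y hx hy =>
    obtain ⟨a, rfl⟩ := hx
    obtain ⟨b, rfl⟩ := hy
    exact ⟨a * b, by simp⟩
  | add x y hx hy =>
    obtain ⟨a, rfl⟩ := hx
    obtain ⟨b, rfl⟩ := hy
    exact ⟨a + b, by simp⟩

/-- Needed for products of smooth maps into `Cl n`, since smoothness is tested by linear
functionals. -/
instance finiteDimensional_cl (n : ℕ) : FiniteDimensional ℝ (Cl n) := by
  induction n with
  | zero =>
    refine Module.Finite.of_surjective (Algebra.linearMap ℝ (Cl 0)) fun x => ?_
    obtain ⟨r, rfl⟩ := exists_algebraMap_eq_of_cl_zero x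
    exact ⟨r, rfl⟩
  | succ n ih =>
    refine Module.Finite.of_surjective
      ((clIncl n).toLinearMap.coprod
        ((LinearMap.mulRight ℝ (vec (lastVec n))).comp (clIncl n).toLinearMap)) fun x => ?_
    obtain ⟨a, b, rfl⟩ := exists_clIncl_add_mul_lastVec x
    exact ⟨(a, b), rfl⟩

theorem involute_vec {n : ℕ} (v : Eucl n) : CliffordAlgebra.involute (vec v) = -vec v :=
  CliffordAlgebra.involute_ι v

/-- The twisted centre of `Cl n` consists of the scalars. -/
theorem exists_algebraMap_eq_of_twisted_comm {n : ℕ} (x : Cl n)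
    (hx : ∀ v : Eucl n, vec v * x = CliffordAlgebra.involute x * vec v) :
    ∃ r : ℝ, x = algebraMap ℝ (Cl n) r := by
  induction n with
  | zero => exact exists_algebraMap_eq_of_cl_zero x
  | succ n ih =>
    obtain ⟨a, b, rfl⟩ := exists_clIncl_add_mul_lastVec x
    have hb : b = 0 := by
      -- Testing against `eₙ₊₁`, the terms with `a` agree and those with `b` differ by a sign, so `b
      -- = 0`. The vectors of `ℝⁿ` then give the hypothesis of the induction for `a`.
      have h := hx (lastVec n)
      rw [map_add, map_mul, involute_vec, ← clIncl_involute, ← clIncl_involute, mul_add,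
        ← mul_assoc, clIncl_involute_comm, clIncl_involute_comm, mul_assoc, add_mul, mul_assoc,
        neg_mul, vec_lastVec_sq, neg_neg, mul_neg, mul_one] at h
      have h1 : clIncl n (CliffordAlgebra.involute b) = 0 := by
        have h2 := add_left_cancel h
        exact eq_zero_of_neg_eq_self (by simpa using h2)
      have h3 := clIncl_injective n (h1.trans (map_zero _).symm)
      have h4 := congrArg CliffordAlgebra.involute h3
      rwa [CliffordAlgebra.involute_involute, map_zero] at h4
    subst hb
    obtain ⟨r, hr⟩ := ih a fun v => by
      have h := hx (incl n v)
      simp only [map_zero, zero_mul, add_zero] at h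
      rw [← clIncl_vec, ← clIncl_involute, ← map_mul, ← map_mul] at h
      exact clIncl_injective n h
    refine ⟨r, ?_⟩
    rw [hr]
    simp

/-! ### Spin groups -/

theorem Ad_eq_of_vec_mul_eq {n : ℕ} {g : Spin n} {v w : Eucl n}
    (h : vec w * (g : Cl n) = g * vec v) : Ad g v = w := by
  apply vec_injective
  rw [vec_Ad, ← h, mul_assoc, spin_mul_inv, mul_one]

/-- A nonzero vector as a unit of the Clifford algebra. -/
def vecUnit {n : ℕ} (v : Eucl n) (hv : v ≠ 0) : (Cl n)ˣ where
  val := vec v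
  inv := (-⟪v, v⟫)⁻¹ • vec v
  val_inv := by
    rw [mul_smul_comm, vec_mul_self, Algebra.algebraMap_eq_smul_one, smul_smul, inv_mul_cancel₀,
      one_smul]
    simpa using hv
  inv_val := by
    rw [smul_mul_assoc, vec_mul_self, Algebra.algebraMap_eq_smul_one, smul_smul, inv_mul_cancel₀,
      one_smul]
    simpa using hv

theorem vecUnit_mem_lipschitzGroup {n : ℕ} (v : Eucl n) (hv : v ≠ 0) :
    vecUnit v hv ∈ lipschitzGroup (cliffordForm n) :=
  Subgroup.subset_closure ⟨v, rfl⟩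

theorem vec_mul_vec_mem_spinGroup {n : ℕ} {v w : Eucl n} (hv : ‖v‖ = 1) (hw : ‖w‖ = 1) :
    vec v * vec w ∈ spinGroup (cliffordForm n) := by
  have hv0 : v ≠ 0 := by rintro rfl; simp at hv
  have hw0 : w ≠ 0 := by rintro rfl; simp at hw
  have hv' := vec_mul_self_of_norm_eq_one hv
  have hw' := vec_mul_self_of_norm_eq_one hw
  refine ⟨⟨⟨vecUnit v hv0 * vecUnit w hw0,
    mul_mem (vecUnit_mem_lipschitzGroup v hv0) (vecUnit_mem_lipschitzGroup w hw0), rfl⟩,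
    SetLike.mem_coe.2 (Unitary.mem_iff.2 ?_)⟩,
    CliffordAlgebra.ι_mul_ι_mem_evenOdd_zero (cliffordForm n) v w⟩
  have hs : star (vec v * vec w) = vec w * vec v := by
    rw [star_mul, CliffordAlgebra.star_ι, CliffordAlgebra.star_ι, neg_mul_neg]
  rw [hs]
  constructor
  · rw [mul_assoc, ← mul_assoc (vec v), hv', neg_mul, one_mul, mul_neg, hw', neg_neg]
  · rw [mul_assoc, ← mul_assoc (vec w), hw', neg_mul, one_mul, mul_neg, hv', neg_neg]

/-- The rotation of the plane of `u₀` and `u` with `u₀ ↦ u`, lifted to the spin group. -/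
def rotor {n : ℕ} (u₀ u : Eucl n) : Spin n :=
  open Classical in
  if h : ‖u₀‖ = 1 ∧ u + u₀ ≠ 0 then
    ⟨vec (‖u + u₀‖⁻¹ • (u + u₀)) * vec u₀,
      vec_mul_vec_mem_spinGroup (norm_smul_inv_norm (𝕜 := ℝ) h.2) h.1⟩
  else 1

theorem coe_rotor {n : ℕ} {u₀ u : Eucl n} (h₀ : ‖u₀‖ = 1) (h : u + u₀ ≠ 0) :
    (rotor u₀ u : Cl n) = ‖u + u₀‖⁻¹ • (vec (u + u₀) * vec u₀) := by
  rw [rotor, dif_pos ⟨h₀, h⟩, ← smul_mul_assoc, ← vec_smul]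

/-- Up to the norm factor, the rotor is `g = (u + u₀) u₀`, and `u g` and `g u₀` both equal `-(u +
u₀)`, as `u² = u₀² = -1`. -/
theorem Ad_rotor {n : ℕ} {u₀ u : Eucl n} (h₀ : ‖u₀‖ = 1) (hu : ‖u‖ = 1) (h : u + u₀ ≠ 0) :
    Ad (rotor u₀ u) u₀ = u := by
  apply Ad_eq_of_vec_mul_eq
  have h1 := vec_mul_self_of_norm_eq_one h₀
  have h2 := vec_mul_self_of_norm_eq_one hu
  rw [coe_rotor h₀ h, mul_smul_comm, smul_mul_assoc, mul_assoc (vec (u + u₀)), h1, ← mul_assoc,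
    vec_add, mul_add, h2, add_mul, mul_assoc, h1]
  congr 1
  simp [add_comm]

/-- The rotor reaches every unit vector but the antipode `-eₙ₊₁`. That one is reached by `w eₙ₊₁`
with a unit vector `w ⟂ eₙ₊₁`, which exists because `n ≥ 1`. -/
theorem exists_Ad_lastVec_eq {n : ℕ} (hn : 1 ≤ n) {u : Eucl (n + 1)} (hu : ‖u‖ = 1) :
    ∃ g : Spin (n + 1), Ad g (lastVec n) = u := by
  by_cases h : u + lastVec n = 0
  · let w : Eucl (n + 1) := EuclideanSpace.single (Fin.castSucc ⟨0, hn⟩) 1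
    have hw : ‖w‖ = 1 := by simp [w]
    refine ⟨⟨vec w * vec (lastVec n), vec_mul_vec_mem_spinGroup hw (norm_lastVec n)⟩, ?_⟩
    apply Ad_eq_of_vec_mul_eq
    have hin : ⟪w, lastVec n⟫ = 0 := by 
      have h0 : (Fin.castSucc ⟨0, hn⟩ : Fin (n + 1)) ≠ Fin.last n := (Fin.castSucc_lt_last _).ne
      rw [lastVec, EuclideanSpace.inner_single_right]
      simp only [w, PiLp.single_apply, h0.symm, if_false, map_zero, mul_zero]
    have hc := vec_mul_vec_add_swap w (lastVec n)
    rw [hin, mul_zero, neg_zero, map_zero] at hc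
    rw [eq_neg_of_add_eq_zero_left h, vec_neg, ← mul_assoc, neg_mul,
      ← eq_neg_of_add_eq_zero_left hc]
  · exact ⟨_, Ad_rotor (norm_lastVec n) hu h⟩

/-- The Lipschitz group is generated by invertible vectors, and `r = (r w) w⁻¹` for any nonzero
vector `w`; this is where `n ≥ 1` enters. -/
theorem algebraMap_mem_lipschitzGroup {n : ℕ} (hn : 1 ≤ n) {u : (Cl n)ˣ} {r : ℝ}
    (hu : (u : Cl n) = algebraMap ℝ (Cl n) r) : u ∈ lipschitzGroup (cliffordForm n) := by
  have hr : r ≠ 0 := by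
    rintro rfl
    exact u.ne_zero (by rw [hu, map_zero])
  let w : Eucl n := EuclideanSpace.single ⟨0, hn⟩ 1
  have hw : w ≠ 0 := by
    intro h
    have : ‖w‖ = 1 := by simp [w]
    rw [h, norm_zero] at this
    exact zero_ne_one this
  have hrw : r • w ≠ 0 := smul_ne_zero hr hw
  have : u = vecUnit (r • w) hrw * (vecUnit w hw)⁻¹ := by
    rw [eq_mul_inv_iff_mul_eq]
    apply Units.ext
    simp [vecUnit, hu, Algebra.smul_def]
  rw [this]
  exact mul_mem (vecUnit_mem_lipschitzGroup _ hrw) (inv_mem (vecUnit_mem_lipschitzGroup _ hw))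

/-- Every orthogonal map of `ℝⁿ` is the twisted adjoint action of an element of the Lipschitz
group. -/
theorem exists_lipschitzGroup_lift {n : ℕ} (φ : Eucl n ≃ₗᵢ[ℝ] Eucl n) :
    ∃ u ∈ lipschitzGroup (cliffordForm n), ∀ v : Eucl n,
      CliffordAlgebra.involute (u : Cl n) * vec v = vec (φ v) * u := by
  -- By Cartan–Dieudonné it suffices to lift reflections, and the reflection along `v ≠ 0` is lifted
  -- by `v` itself. For `v = 0` the reflection is the identity.
  have hφ : φ ∈ Subgroup.closure
      (Set.range fun v : Eucl n => (Submodule.span ℝ {v})ᗮ.reflection) := by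
    rw [LinearIsometryEquiv.reflections_generate]; trivial
  induction hφ using Subgroup.closure_induction with
  | mem x hx =>
    obtain ⟨v, rfl⟩ := hx
    by_cases hv : v = 0
    · refine ⟨1, one_mem _, fun w => ?_⟩
      subst hv
      have : (Submodule.span ℝ {(0 : Eucl n)})ᗮ.reflection w = w :=
        Submodule.reflection_mem_subspace_eq_self (by simp)
      rw [this]
      simp
    · refine ⟨vecUnit v hv, vecUnit_mem_lipschitzGroup v hv, fun w => ?_⟩
      have hr : (Submodule.span ℝ {v})ᗮ.reflection w = w - (2 * (⟪v, w⟫ / ⟪v, v⟫)) • v := by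
        rw [Submodule.reflection_orthogonal_apply, Submodule.reflection_singleton_apply]
        rw [real_inner_self_eq_norm_sq, neg_sub, mul_smul, two_smul ℝ, two_smul ℕ]
        simp
      have hv' : ⟪v, v⟫ ≠ 0 := by simpa using hv
      rw [hr]
      change CliffordAlgebra.involute (vec v) * vec w = _ * vec v
      have h := vec_mul_vec_add_swap v w
      rw [involute_vec, vec_sub, vec_smul, sub_mul, smul_mul_assoc, vec_mul_self, Algebra.smul_def,
        ← map_mul (algebraMap ℝ (Cl n))]
      have h2 : 2 * (⟪v, w⟫ / ⟪v, v⟫) * -⟪v, v⟫ = -(2 * ⟪v, w⟫) := by field_simp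
      rw [h2, ← h]
      simp
  | one => exact ⟨1, one_mem _, fun v => by simp⟩
  | mul x y _ _ hx hy =>
    obtain ⟨a, ha, ha'⟩ := hx
    obtain ⟨b, hb, hb'⟩ := hy
    refine ⟨a * b, mul_mem ha hb, fun v => ?_⟩
    rw [Units.val_mul, map_mul, mul_assoc, hb', ← mul_assoc, ha', mul_assoc]
    rfl
  | inv x _ hx =>
    obtain ⟨a, ha, ha'⟩ := hx
    refine ⟨a⁻¹, inv_mem ha, fun v => ?_⟩
    have h := ha' (x⁻¹ v)
    have hx : x (x⁻¹ v) = v := x.apply_symm_apply v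
    rw [hx] at h
    have h1 : CliffordAlgebra.involute ((a⁻¹ : (Cl n)ˣ) : Cl n) *
        CliffordAlgebra.involute (a : Cl n) = 1 := by
      rw [← map_mul, Units.inv_mul, map_one]
    calc _ = CliffordAlgebra.involute ((a⁻¹ : (Cl n)ˣ) : Cl n) * (vec v * a)
          * ((a⁻¹ : (Cl n)ˣ) : Cl n) := by
          rw [mul_assoc, mul_assoc, Units.mul_inv, mul_one]
      _ = _ := by rw [← h, ← mul_assoc, h1, one_mul]

/-- The stabilizer of the last basis vector in `Spin(n+1)` is `Spin(n)`. -/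
theorem exists_spinIncl_eq {n : ℕ} (hn : 1 ≤ n) {h : Spin (n + 1)}
    (hh : Ad h (lastVec n) = lastVec n) : ∃ g : Spin n, spinIncl n g = h := by
  have hcomm : vec (lastVec n) * (h : Cl (n + 1)) = h * vec (lastVec n) := by
    have := vec_Ad h (lastVec n)
    rw [hh] at this
    conv_lhs => rw [this]
    rw [mul_assoc, spin_inv_mul, mul_one]
  have hinv := spinGroup.involute_eq h.2
  obtain ⟨a, b, hab⟩ := exists_clIncl_add_mul_lastVec (h : Cl (n + 1))
  -- Elements of the spin group are even. Comparing coefficients in `h = a + b eₙ₊₁`, `a` is fixed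
  -- and `b` negated by the involution; commuting with `eₙ₊₁` then forces `b = 0`.
  have hinv' : CliffordAlgebra.involute a = a ∧ -CliffordAlgebra.involute b = b := by
    apply clIncl_add_mul_lastVec_injective
    rw [← hab, ← hinv, hab]
    simp [clIncl_involute]
  have hb : b = 0 := by
    rw [hab, mul_add, ← mul_assoc, clIncl_involute_comm, clIncl_involute_comm, hinv'.1, add_mul,
      neg_eq_iff_eq_neg.1 hinv'.2] at hcomm
    have h1 := add_left_cancel hcomm
    rw [mul_assoc, mul_assoc, vec_lastVec_sq, map_neg, neg_mul] at h1
    have h2 := eq_zero_of_neg_eq_self h1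
    rw [mul_neg, mul_one, neg_eq_zero] at h2
    exact clIncl_injective n (h2.trans (map_zero _).symm)
  rw [hb, map_zero, zero_mul, add_zero] at hab
  have hu := spinGroup.star_mul_self_of_mem h.2
  have hu' := spinGroup.mul_star_self_of_mem h.2
  rw [hab, ← clIncl_star, ← map_mul, ← map_one (clIncl n)] at hu hu'
  replace hu := clIncl_injective n hu
  replace hu' := clIncl_injective n hu'
  -- It remains to see that `a` lies in the Lipschitz group of `ℝⁿ`, not just in that of `ℝⁿ⁺¹`. `Ad
  -- h` preserves `ℝⁿ = eₙ₊₁^⊥`, and its restriction `φ` lifts to some `u` in that group; `a` and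
  -- `u` have the same twisted action, so `a⁻¹ u` is in the twisted centre and is a scalar.
  let φ₀ : Eucl n →ₗ[ℝ] Eucl n := dropLast n ∘ₗ (AdEquiv h).toLinearMap ∘ₗ incl n
  have hφ₀ : ∀ v, incl n (φ₀ v) = Ad h (incl n v) := fun v => by
    apply incl_dropLast_of_inner_eq_zero
    change ⟪Ad h (incl n v), lastVec n⟫ = 0
    rw [← hh, Ad_inner, inner_incl_lastVec]
  let φ : Eucl n ≃ₗᵢ[ℝ] Eucl n := LinearIsometry.toLinearIsometryEquiv
    (φ₀.isometryOfInner fun v w => by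
      rw [← inner_incl, hφ₀, hφ₀, Ad_inner, inner_incl]) rfl
  have hφ : ∀ v, vec (φ v) * a = a * vec v := fun v => by
    apply clIncl_injective n
    rw [map_mul, map_mul, ← hab, clIncl_vec, clIncl_vec]
    change vec (incl n (φ₀ v)) * _ = _
    rw [hφ₀, vec_Ad, mul_assoc, spin_inv_mul, mul_one]
  obtain ⟨u, hu1, hu2⟩ := exists_lipschitzGroup_lift φ
  have hstar : CliffordAlgebra.involute (star a) = star a := by
    rw [CliffordAlgebra.star_def', CliffordAlgebra.involute_involute,
      ← CliffordAlgebra.reverse_involute, hinv'.1]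
  obtain ⟨r, hr⟩ := exists_algebraMap_eq_of_twisted_comm (star a * (u : Cl n)) fun v => by
    rw [map_mul, hstar, mul_assoc, hu2]
    calc vec v * (star a * u) = (star a * a) * vec v * star a * u := by
          rw [hu, one_mul, mul_assoc]
      _ = star a * (a * vec v) * star a * u := by simp only [mul_assoc]
      _ = star a * vec (φ v) * (a * star a) * u := by rw [← hφ]; simp only [mul_assoc]
      _ = _ := by rw [hu', mul_one, mul_assoc]
  let ua : (Cl n)ˣ := ⟨a, star a, hu', hu⟩
  have hua : ua ∈ lipschitzGroup (cliffordForm n) := by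
    have h1 : ua⁻¹ * u ∈ lipschitzGroup (cliffordForm n) := algebraMap_mem_lipschitzGroup hn hr
    have h2 := mul_mem hu1 (inv_mem h1)
    simpa using h2
  refine ⟨⟨a, ⟨⟨ua, hua, rfl⟩, SetLike.mem_coe.2 (Unitary.mem_iff.2 ⟨hu, hu'⟩)⟩, ?_⟩,
    Subtype.ext hab.symm⟩
  change a ∈ CliffordAlgebra.evenOdd (cliffordForm n) 0
  -- Being fixed by the involution, `a` has an odd part equal to its own negative.
  obtain ⟨p, hp, q, hq, hpq⟩ := Submodule.mem_sup.1
    ((CliffordAlgebra.evenOdd_isCompl (cliffordForm n)).sup_eq_top ▸ Submodule.mem_top (x := a))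
  have h1 := hinv'.1
  rw [← hpq, map_add, CliffordAlgebra.involute_eq_of_mem_even hp,
    CliffordAlgebra.involute_eq_of_mem_odd hq, add_right_inj] at h1
  rwa [← hpq, eq_zero_of_neg_eq_self h1, add_zero]

theorem spinIncl_injective (n : ℕ) : Function.Injective (spinIncl n) := fun _ _ h =>
  Subtype.ext (clIncl_injective n (congrArg Subtype.val h))

end SpinGeom

end

noncomputable section

namespace SpinGeom

/-! ### Vectors and basis products in the complex Clifford algebra -/

/-- The inclusion of vectors `ℝⁿ → ℂ ⊗ Cl n`. -/
abbrev cvec {n : ℕ} (v : Eucl n) : CCl n := 1 ⊗ₜ[ℝ] vec v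

theorem cvec_mul_self_of_norm_eq_one {n : ℕ} {v : Eucl n} (hv : ‖v‖ = 1) :
    cvec v * cvec v = -1 := by
  rw [Algebra.TensorProduct.tmul_mul_tmul, vec_mul_self_of_norm_eq_one hv, TensorProduct.tmul_neg,
    one_mul, Algebra.TensorProduct.one_def]

theorem cvec_mul_cvec_of_inner_eq_zero {n : ℕ} {v w : Eucl n} (h : ⟪v, w⟫ = 0) :
    cvec v * cvec w = -(cvec w * cvec v) := by
  have h1 := vec_mul_vec_add_swap v w
  rw [h, mul_zero, neg_zero, map_zero] at h1
  rw [Algebra.TensorProduct.tmul_mul_tmul, Algebra.TensorProduct.tmul_mul_tmul,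
    eq_neg_of_add_eq_zero_left h1, TensorProduct.tmul_neg]

theorem tmul_eq_smul {n : ℕ} (z : ℂ) (x : Cl n) : (z ⊗ₜ[ℝ] x : CCl n) = z • (1 ⊗ₜ[ℝ] x) := by
  rw [TensorProduct.smul_tmul', smul_eq_mul, mul_one]

theorem cvec_incl_add_smul {n : ℕ} (v : Eucl (n + 1)) :
    cvec v = cvec (incl n (dropLast n v)) + (v (Fin.last n) : ℂ) • cvec (lastVec n) := by
  conv_lhs => rw [← incl_dropLast_add v]
  rw [cvec, vec_add, TensorProduct.tmul_add, vec_smul, TensorProduct.tmul_smul]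
  rfl

/-- The vectors generate the complex Clifford algebra. -/
theorem adjoin_range_cvec (n : ℕ) : Algebra.adjoin ℂ (Set.range (cvec (n := n))) = ⊤ := by
  rw [eq_top_iff]
  rintro x -
  induction x using TensorProduct.induction_on with
  | zero => exact zero_mem _
  | add x y hx hy => exact add_mem hx hy
  | tmul z x =>
    rw [tmul_eq_smul]
    refine Subalgebra.smul_mem _ ?_ z
    induction x using CliffordAlgebra.induction with
    | algebraMap r =>
      have : (1 ⊗ₜ[ℝ] algebraMap ℝ (Cl n) r : CCl n) = algebraMap ℂ (CCl n) (r : ℂ) := by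
        rw [Algebra.algebraMap_eq_smul_one, ← TensorProduct.smul_tmul]
        simp [Algebra.TensorProduct.algebraMap_apply]
      rw [this]
      exact Subalgebra.algebraMap_mem _ _
    | ι v => exact Algebra.subset_adjoin ⟨v, rfl⟩
    | mul a b ha hb =>
      have := mul_mem ha hb
      rwa [Algebra.TensorProduct.tmul_mul_tmul, one_mul] at this
    | add a b ha hb =>
      rw [TensorProduct.tmul_add]
      exact add_mem ha hb

section Representations

variable {n : ℕ} {V W : Type*} [AddCommGroup V] [Module ℂ V] [AddCommGroup W] [Module ℂ W]

theorem comm_of_comm_cvec {ρ : CCl n →ₐ[ℂ] Module.End ℂ V} {σ : CCl n →ₐ[ℂ] Module.End ℂ W}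
    {T : V →ₗ[ℂ] W} (h : ∀ v w, T (ρ (cvec v) w) = σ (cvec v) (T w)) (a : CCl n) (w : V) :
    T (ρ a w) = σ a (T w) := by
  have ha : a ∈ Algebra.adjoin ℂ (Set.range (cvec (n := n))) := by
    rw [adjoin_range_cvec]; trivial
  induction ha using Algebra.adjoin_induction generalizing w with
  | mem x hx => obtain ⟨v, rfl⟩ := hx; exact h v w
  | algebraMap r =>
    rw [AlgHom.commutes, AlgHom.commutes, Module.algebraMap_end_apply, map_smul,
      Module.algebraMap_end_apply]
  | add x y _ _ hx hy => simp [hx, hy]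
  | mul x y _ _ hx hy => simp [hx, hy]

theorem apply_mem_of_cvec_apply_mem {ρ : CCl n →ₐ[ℂ] Module.End ℂ V} {p : Submodule ℂ V}
    (h : ∀ v, ∀ w ∈ p, ρ (cvec v) w ∈ p) (a : CCl n) {w : V} (hw : w ∈ p) : ρ a w ∈ p := by
  have ha : a ∈ Algebra.adjoin ℂ (Set.range (cvec (n := n))) := by
    rw [adjoin_range_cvec]; trivial
  induction ha using Algebra.adjoin_induction generalizing w with
  | mem x hx => obtain ⟨v, rfl⟩ := hx; exact h v w hw
  | algebraMap r =>
    rw [AlgHom.commutes, Module.algebraMap_end_apply]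
    exact p.smul_mem r hw
  | add x y _ _ hx hy => simpa using p.add_mem (hx hw) (hy hw)
  | mul x y _ _ hx hy => simpa using hx (hy hw)

theorem cvec_apply_cvec_apply (ρ : CCl n →ₐ[ℂ] Module.End ℂ V) {v : Eucl n} (hv : ‖v‖ = 1)
    (x : V) : ρ (cvec v) (ρ (cvec v) x) = -x := by
  rw [← Module.End.mul_apply, ← map_mul, cvec_mul_self_of_norm_eq_one hv, map_neg, map_one,
    LinearMap.neg_apply, Module.End.one_apply]

theorem cvec_apply_cvec_apply_of_inner_eq_zero (ρ : CCl n →ₐ[ℂ] Module.End ℂ V) {v w : Eucl n}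
    (h : ⟪v, w⟫ = 0) (x : V) : ρ (cvec v) (ρ (cvec w) x) = -ρ (cvec w) (ρ (cvec v) x) := by
  rw [← Module.End.mul_apply, ← Module.End.mul_apply, ← map_mul, ← map_mul,
    cvec_mul_cvec_of_inner_eq_zero h, map_neg, LinearMap.neg_apply]

end Representations

/-- The product `e₁ ⋯ eₙ` of the canonical basis. -/
def basisProd (n : ℕ) : Cl n :=
  (List.ofFn fun i : Fin n => vec (EuclideanSpace.single i (1 : ℝ))).prod

theorem volumeForm_eq (n : ℕ) : volumeForm n = (Complex.I ^ ((n + 1) / 2)) ⊗ₜ[ℝ] basisProd n := rfl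

theorem incl_single {n : ℕ} (i : Fin n) :
    incl n (EuclideanSpace.single i 1) = EuclideanSpace.single i.castSucc 1 := by
  ext j
  refine Fin.lastCases ?_ (fun j => ?_) j
  · simp [incl, (Fin.castSucc_lt_last i).ne']
  · simp [incl, Pi.single_apply]

theorem basisProd_succ (n : ℕ) :
    basisProd (n + 1) = clIncl n (basisProd n) * vec (lastVec n) := by
  rw [basisProd, List.ofFn_succ', List.concat_eq_append, List.prod_append, basisProd, map_list_prod,
    List.map_ofFn, List.prod_singleton]
  congr 4
  funext i
  rw [Function.comp_apply, clIncl_vec, incl_single]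

theorem basisProd_mem_even {n : ℕ} (hn : Even n) :
    basisProd n ∈ CliffordAlgebra.even (cliffordForm n) := by
  change _ ∈ CliffordAlgebra.evenOdd (cliffordForm n) 0
  have h := SetLike.list_prod_ofFn_mem_graded (A := CliffordAlgebra.evenOdd (cliffordForm n))
    (fun _ : Fin n => (1 : ZMod 2)) (fun i => vec (EuclideanSpace.single i (1 : ℝ)))
    (fun i => CliffordAlgebra.ι_mem_evenOdd_one _ _)
  have h0 : (List.ofFn fun _ : Fin n => (1 : ZMod 2)).sum = 0 := by
    simpa [List.sum_ofFn] using (ZMod.natCast_eq_zero_iff_even).2 hn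
  rwa [h0] at h

theorem involute_basisProd (n : ℕ) :
    CliffordAlgebra.involute (basisProd n) = (-1 : ℝ) ^ n • basisProd n := by
  induction n with
  | zero => simp [basisProd]
  | succ n ih =>
    rw [basisProd_succ, map_mul, ← clIncl_involute, ih, involute_vec, map_smul, pow_succ, mul_smul,
      smul_mul_assoc]
    simp

/-- Each `eᵢ` commutes with its own factor and anticommutes with the other `n - 1`. So the product
is central for `n` odd and anticommutes with vectors for `n` even. -/
theorem vec_mul_basisProd {n : ℕ} (v : Eucl n) :
    vec v * basisProd n = (-1 : ℝ) ^ (n + 1) • (basisProd n * vec v) := by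
  induction n with
  | zero => rw [Subsingleton.elim v 0]; simp [vec]
  | succ n ih =>
    have h1 : vec (incl n (dropLast n v)) * basisProd (n + 1)
        = (-1 : ℝ) ^ (n + 1 + 1) • (basisProd (n + 1) * vec (incl n (dropLast n v))) := by
      rw [basisProd_succ, mul_assoc _ (vec (lastVec n)), ← clIncl_vec, clIncl_involute_comm,
        involute_vec, ← mul_assoc, ← map_mul, ih, ← mul_assoc, ← map_mul, mul_neg, pow_succ _ (n + 1),
        mul_smul, map_smul, map_neg, neg_mul, smul_mul_assoc]
      simp
    have h2 : vec (lastVec n) * basisProd (n + 1)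
        = (-1 : ℝ) ^ (n + 1 + 1) • (basisProd (n + 1) * vec (lastVec n)) := by
      rw [basisProd_succ, ← mul_assoc, clIncl_involute_comm, involute_basisProd, pow_succ, pow_succ,
        map_smul, smul_mul_assoc, smul_mul_assoc]
      simp
    conv_lhs => rw [← incl_dropLast_add v]
    conv_rhs => rw [← incl_dropLast_add v]
    rw [vec_add, vec_smul, add_mul, mul_add, smul_add, h1, smul_mul_assoc, h2, mul_smul_comm,
      smul_comm]

theorem basisProd_mul_self (n : ℕ) :
    basisProd n * basisProd n = algebraMap ℝ (Cl n) ((-1) ^ ((n + 1) / 2)) := by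
  induction n with
  | zero => simp [basisProd]
  | succ n ih =>
    have : ((-1 : ℝ)) ^ ((n + 1 + 1) / 2) = -((-1) ^ n * (-1) ^ ((n + 1) / 2)) := by
      rcases Nat.even_or_odd' n with ⟨k, rfl | rfl⟩
      · rw [show (2 * k + 1 + 1) / 2 = k + 1 by omega, show (2 * k + 1) / 2 = k by omega, pow_mul]
        simp [pow_succ]
      · rw [show (2 * k + 1 + 1 + 1) / 2 = k + 1 by omega,
          show (2 * k + 1 + 1) / 2 = k + 1 by omega, pow_succ _ (2 * k), pow_mul]
        simp
    rw [this, basisProd_succ, mul_assoc, ← mul_assoc (vec (lastVec n)), clIncl_involute_comm,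
      involute_basisProd, mul_assoc, vec_lastVec_sq, ← mul_assoc, ← map_mul, mul_smul_comm, ih,
      map_smul, AlgHom.commutes, map_neg, map_mul, ← Algebra.smul_def]
    simp

/-- The power of `i` in the volume form is chosen to cancel the sign of `basisProd_mul_self`. -/
theorem volumeForm_mul_self (n : ℕ) : volumeForm n * volumeForm n = 1 := by
  rw [volumeForm_eq, Algebra.TensorProduct.tmul_mul_tmul, basisProd_mul_self, ← mul_pow,
    Complex.I_mul_I, Algebra.algebraMap_eq_smul_one, ← TensorProduct.smul_tmul,
    Algebra.TensorProduct.one_def]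
  congr 1
  rw [Complex.real_smul]
  push_cast
  rw [← mul_pow]
  simp

theorem cvec_mul_volumeForm_of_even {n : ℕ} (hn : Even n) (v : Eucl n) :
    cvec v * volumeForm n = -(volumeForm n * cvec v) := by
  rw [volumeForm_eq, Algebra.TensorProduct.tmul_mul_tmul, Algebra.TensorProduct.tmul_mul_tmul,
    vec_mul_basisProd, hn.add_one.neg_one_pow, mul_comm]
  simp [TensorProduct.tmul_neg]

/-- The inclusion `ℂ ⊗ Cl n → ℂ ⊗ Cl (n+1)`. -/
def cclIncl (n : ℕ) : CCl n →ₐ[ℂ] CCl (n + 1) :=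
  Algebra.TensorProduct.map (AlgHom.id ℂ ℂ) (clIncl n)

@[simp] theorem cclIncl_tmul {n : ℕ} (z : ℂ) (x : Cl n) :
    cclIncl n (z ⊗ₜ[ℝ] x) = z ⊗ₜ[ℝ] clIncl n x := rfl

/-- Where `ωₙ₊₁` acts as the identity, this expresses the action of `eₙ₊₁` through `e₁ ⋯ eₙ`. -/
theorem volumeForm_mul_lastVec (n : ℕ) :
    volumeForm (n + 1) * cvec (lastVec n)
      = -(Complex.I ^ ((n + 1 + 1) / 2) • cclIncl n (1 ⊗ₜ[ℝ] basisProd n)) := by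
  rw [volumeForm_eq, Algebra.TensorProduct.tmul_mul_tmul, basisProd_succ, mul_assoc, vec_lastVec_sq,
    cclIncl_tmul, ← tmul_eq_smul, ← TensorProduct.tmul_neg]
  simp

/-! ### Uniqueness of the spinor representation -/

section Uniqueness

variable {V W : Type*} [AddCommGroup V] [Module ℂ V] [AddCommGroup W] [Module ℂ W]

theorem inner_single_single {n : ℕ} {i j : Fin n} (h : i ≠ j) :
    ⟪(EuclideanSpace.single i 1 : Eucl n), EuclideanSpace.single j 1⟫ = 0 := by
  rw [EuclideanSpace.inner_single_right, PiLp.single_apply, if_neg h.symm]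
  simp

/-- The basis vectors are treated one at a time, starting from a map of rank one. Given `T` that
commutes with the earlier ones, either averaging over the next vector `e` succeeds, or `T`
anticommutes with `e` and the sign can be corrected. Neither irreducibility nor finite dimension is
involved. -/
theorem exists_ne_zero_comm_single {n : ℕ} (hn : Even n) [Nontrivial V] [Nontrivial W]
    (ρ : CCl n →ₐ[ℂ] Module.End ℂ V) (σ : CCl n →ₐ[ℂ] Module.End ℂ W) {k : ℕ} (hk : k ≤ n) :
    ∃ T : V →ₗ[ℂ] W, T ≠ 0 ∧ ∀ i : Fin n, (i : ℕ) < k → ∀ v,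
      T (ρ (cvec (EuclideanSpace.single i 1)) v) = σ (cvec (EuclideanSpace.single i 1)) (T v) := by
  induction k with
  | zero =>
    obtain ⟨v, hv⟩ := exists_ne (0 : V)
    obtain ⟨w, hw⟩ := exists_ne (0 : W)
    obtain ⟨f, hf⟩ : ∃ f : Module.Dual ℂ V, f v ≠ 0 := by
      by_contra! h
      exact hv ((Module.forall_dual_apply_eq_zero_iff ℂ v).1 h)
    refine ⟨f.smulRight w, fun h => ?_, fun i hi => absurd hi (Nat.not_lt_zero _)⟩
    have := LinearMap.congr_fun h v
    simp [hf, hw] at this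
  | succ k ih =>
    obtain ⟨T, hT, hTi⟩ := ih (Nat.le_of_succ_le hk)
    let κ : Fin n := ⟨k, hk⟩
    let e : Fin n → Eucl n := fun i => EuclideanSpace.single i 1
    have he : ‖e κ‖ = 1 := by simp [e]
    have hsq := cvec_apply_cvec_apply ρ he
    have hsq' := cvec_apply_cvec_apply σ he
    have hac : ∀ i, i ≠ κ → ∀ x, ρ (cvec (e κ)) (ρ (cvec (e i)) x)
        = -ρ (cvec (e i)) (ρ (cvec (e κ)) x) := fun i hi =>
      cvec_apply_cvec_apply_of_inner_eq_zero ρ (inner_single_single hi.symm)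
    have hac' : ∀ i, i ≠ κ → ∀ x, σ (cvec (e κ)) (σ (cvec (e i)) x)
        = -σ (cvec (e i)) (σ (cvec (e κ)) x) := fun i hi =>
      cvec_apply_cvec_apply_of_inner_eq_zero σ (inner_single_single hi.symm)
    have hlt : ∀ i : Fin n, (i : ℕ) < k + 1 → i = κ ∨ (i ≠ κ ∧ (i : ℕ) < k) := fun i hi => by
      by_cases h : i = κ
      · exact Or.inl h
      · refine Or.inr ⟨h, ?_⟩
        have : (i : ℕ) ≠ k := fun h' => h (Fin.ext h')
        omega
    -- As `e⁻¹ = -e`, this is `T + e T e⁻¹`, which commutes with `e` and still with the earlier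
    -- basis vectors.
    let T₁ : V →ₗ[ℂ] W := T - σ (cvec (e κ)) ∘ₗ T ∘ₗ ρ (cvec (e κ))
    have hT₁ : ∀ v, T₁ v = T v - σ (cvec (e κ)) (T (ρ (cvec (e κ)) v)) := fun v => rfl
    by_cases h1 : T₁ = 0
    · have hTκ : ∀ v, σ (cvec (e κ)) (T v) = -T (ρ (cvec (e κ)) v) := fun v => by
        have := hT₁ v
        rw [h1, LinearMap.zero_apply, eq_comm, sub_eq_zero] at this
        rw [this, hsq']
      have hP : ∀ u : Eucl n, ∀ x, ρ (1 ⊗ₜ basisProd n) (ρ (cvec u) x)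
          = -ρ (cvec u) (ρ (1 ⊗ₜ basisProd n) x) := fun u x => by
        rw [← Module.End.mul_apply, ← Module.End.mul_apply, ← map_mul, ← map_mul,
          Algebra.TensorProduct.tmul_mul_tmul, Algebra.TensorProduct.tmul_mul_tmul,
          vec_mul_basisProd, hn.add_one.neg_one_pow, neg_one_smul, TensorProduct.tmul_neg, map_neg,
          LinearMap.neg_apply, neg_neg]
      have hPP : ∀ x, ρ (1 ⊗ₜ basisProd n) (ρ (1 ⊗ₜ basisProd n) x)
          = ((-1 : ℝ) ^ ((n + 1) / 2) : ℂ) • x := fun x => by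
        rw [← Module.End.mul_apply, ← map_mul, Algebra.TensorProduct.tmul_mul_tmul,
          basisProd_mul_self, Algebra.algebraMap_eq_smul_one, TensorProduct.tmul_smul, one_mul,
          ← Algebra.TensorProduct.one_def]
        have : (((-1 : ℝ) ^ ((n + 1) / 2)) • (1 : CCl n))
            = ((-1 : ℝ) ^ ((n + 1) / 2) : ℂ) • (1 : CCl n) := by
          rw [← Complex.ofReal_pow]; rfl
        rw [this, map_smul, map_one]
        rfl
      -- For `n` even `e₁ ⋯ eₙ` anticommutes with all vectors, so `e · e₁ ⋯ eₙ` anticommutes with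
      -- `e` and commutes with every other basis vector. Composing with it repairs the sign at `e`
      -- alone, and it is invertible.
      refine ⟨T ∘ₗ ρ (cvec (e κ)) ∘ₗ ρ (1 ⊗ₜ basisProd n), fun h0 => hT ?_, fun i hi v => ?_⟩
      · ext v
        have := LinearMap.congr_fun h0 (ρ (1 ⊗ₜ basisProd n) (ρ (cvec (e κ)) v))
        simp only [LinearMap.comp_apply, hPP, map_smul, hsq, LinearMap.zero_apply, map_neg] at this
        simpa [hsq] using this
      · change T (ρ (cvec (e κ)) (ρ (1 ⊗ₜ basisProd n) (ρ (cvec (e i)) v)))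
          = σ (cvec (e i)) (T (ρ (cvec (e κ)) (ρ (1 ⊗ₜ basisProd n) v)))
        rw [hP, map_neg, map_neg]
        rcases hlt i hi with rfl | ⟨hiκ, hi⟩
        · rw [hTκ]
        · rw [hac i hiκ, map_neg, neg_neg]
          exact hTi i hi _
    · refine ⟨T₁, h1, fun i hi v => ?_⟩
      change T₁ (ρ (cvec (e i)) v) = σ (cvec (e i)) (T₁ v)
      rw [hT₁, hT₁, map_sub]
      rcases hlt i hi with rfl | ⟨hiκ, hi⟩
      · rw [hsq, hsq', map_neg, map_neg]
        abel
      · have h2 := hTi i hi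
        change ∀ v, T (ρ (cvec (e i)) v) = σ (cvec (e i)) (T v) at h2
        rw [h2, hac i hiκ, map_neg, h2, map_neg, hac' i hiκ, neg_neg]

theorem exists_ne_zero_comm_of_even {n : ℕ} (hn : Even n) [Nontrivial V] [Nontrivial W]
    (ρ : CCl n →ₐ[ℂ] Module.End ℂ V) (σ : CCl n →ₐ[ℂ] Module.End ℂ W) :
    ∃ T : V →ₗ[ℂ] W, T ≠ 0 ∧ ∀ a v, T (ρ a v) = σ a (T v) := by
  obtain ⟨T, hT, h⟩ := exists_ne_zero_comm_single hn ρ σ le_rfl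
  refine ⟨T, hT, comm_of_comm_cvec fun v w => ?_⟩
  have hv : cvec v = ∑ i, (v i : ℂ) • cvec (EuclideanSpace.single i 1) := by
    have h1 : v = ∑ i, v i • EuclideanSpace.single i (1 : ℝ) := by
      ext j; simp [Pi.single_apply]
    conv_lhs => rw [h1]
    rw [cvec, vec, map_sum, TensorProduct.tmul_sum]
    refine Finset.sum_congr rfl fun i _ => ?_
    rw [map_smul, TensorProduct.tmul_smul]
    rfl
  simp only [hv, map_sum, map_smul, LinearMap.sum_apply, LinearMap.smul_apply]
  exact Finset.sum_congr rfl fun i _ => by rw [h i i.2]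

/-- For `n = m + 1` odd, an intertwiner for `Cl m` is enough: the normalization of the volume form
writes `eₙ` as the same element of `ℂ ⊗ Cl m` in both representations. -/
theorem IsSpinorRep.exists_ne_zero_comm {n : ℕ} {ρ : CCl n →ₐ[ℂ] Module.End ℂ V}
    {σ : CCl n →ₐ[ℂ] Module.End ℂ W} (hρ : IsSpinorRep ρ) (hσ : IsSpinorRep σ) :
    ∃ T : V →ₗ[ℂ] W, T ≠ 0 ∧ ∀ a v, T (ρ a v) = σ a (T v) := by
  have := hρ.nontrivial
  have := hσ.nontrivial
  rcases Nat.even_or_odd n with hn | hn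
  · exact exists_ne_zero_comm_of_even hn ρ σ
  · obtain ⟨m, rfl⟩ : ∃ m, n = m + 1 := ⟨n - 1, by have := hn.pos; omega⟩
    have hm : Even m := by
      by_contra h
      exact Nat.not_even_iff_odd.2 hn (Nat.not_even_iff_odd.1 h).add_one
    obtain ⟨T, hT, h⟩ := exists_ne_zero_comm_of_even hm (ρ.comp (cclIncl m)) (σ.comp (cclIncl m))
    simp only [AlgHom.comp_apply] at h
    refine ⟨T, hT, comm_of_comm_cvec fun v w => ?_⟩
    have hv := cvec_incl_add_smul v
    have h1 : cvec (incl m (dropLast m v)) = cclIncl m (cvec (dropLast m v)) := by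
      rw [cclIncl_tmul, clIncl_vec]
    have h2 := congrArg ρ (volumeForm_mul_lastVec m)
    have h3 := congrArg σ (volumeForm_mul_lastVec m)
    rw [map_mul, hρ.volume_eq_one hn, one_mul] at h2
    rw [map_mul, hσ.volume_eq_one hn, one_mul] at h3
    rw [hv, h1]
    simp only [map_add, map_smul, h2, h3, map_neg, LinearMap.add_apply, LinearMap.smul_apply,
      LinearMap.neg_apply, h]

/-- The spinor representation of `ℂ ⊗ Cl n` is unique up to isomorphism. -/
theorem IsSpinorRep.exists_equiv {n : ℕ} {ρ : CCl n →ₐ[ℂ] Module.End ℂ V}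
    {σ : CCl n →ₐ[ℂ] Module.End ℂ W} (hρ : IsSpinorRep ρ) (hσ : IsSpinorRep σ) :
    ∃ T : V ≃ₗ[ℂ] W, ∀ a v, T (ρ a v) = σ a (T v) := by
  obtain ⟨T, hT, h⟩ := hρ.exists_ne_zero_comm hσ
  -- Schur's lemma: kernel and range of an intertwiner are invariant.
  have hker : LinearMap.ker T = ⊥ := by
    refine (hρ.irreducible (LinearMap.ker T) fun a w hw => ?_).resolve_right fun h0 => hT ?_
    · rw [LinearMap.mem_ker] at hw ⊢
      rw [h, hw, map_zero]
    · exact LinearMap.ker_eq_top.1 h0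
  have hrange : LinearMap.range T = ⊤ := by
    refine (hσ.irreducible (LinearMap.range T) ?_).resolve_left fun h0 => hT ?_
    · rintro a _ ⟨w, rfl⟩
      exact ⟨ρ a w, h a w⟩
    · exact LinearMap.range_eq_bot.1 h0
  exact ⟨LinearEquiv.ofBijective T ⟨LinearMap.ker_eq_bot.1 hker, LinearMap.range_eq_top.1 hrange⟩, h⟩

end Uniqueness

end SpinGeom

end

noncomputable section

namespace SpinGeom

/-! ### The embedding of `Cl n` onto the even part of `Cl (n+1)` -/

theorem mul_comm_of_anticomm {A : Type*} [Ring A] {a b c : A} (ha : a * c = -(c * a))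
    (hb : b * c = -(c * b)) : a * b * c = c * (a * b) := by
  rw [mul_assoc, hb, mul_neg, ← mul_assoc, ha, neg_mul, neg_neg, mul_assoc]

theorem incl_mul_lastVec_mul_incl_mul_lastVec {n : ℕ} (v w : Eucl n) :
    vec (incl n v) * vec (lastVec n) * (vec (incl n w) * vec (lastVec n))
      = clIncl n (vec v * vec w) := by
  rw [mul_assoc, ← mul_assoc (vec (lastVec n)), ← clIncl_vec, ← clIncl_vec, clIncl_involute_comm,
    involute_vec, map_neg, neg_mul, neg_mul, mul_assoc, vec_lastVec_sq, map_mul]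
  simp

/-- The homomorphism `Cl n → Cl (n+1)`, `v ↦ v · eₙ₊₁`, onto the even part. -/
def clEven (n : ℕ) : Cl n →ₐ[ℝ] Cl (n + 1) :=
  CliffordAlgebra.lift (cliffordForm n)
    ⟨(LinearMap.mulRight ℝ (vec (lastVec n))).comp
      ((CliffordAlgebra.ι (cliffordForm (n + 1))).comp (incl n)), fun v => by
    change vec (incl n v) * vec (lastVec n) * (vec (incl n v) * vec (lastVec n)) = _
    rw [incl_mul_lastVec_mul_incl_mul_lastVec, CliffordAlgebra.ι_sq_scalar, AlgHom.commutes]⟩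

theorem clEven_vec {n : ℕ} (v : Eucl n) : clEven n (vec v) = vec (incl n v) * vec (lastVec n) :=
  CliffordAlgebra.lift_ι_apply _ _ _

/-- Even elements are sums of products of pairs of vectors, and in each pair the two factors `eₙ₊₁`
cancel. -/
theorem clEven_eq_clIncl {n : ℕ} {x : Cl n} (hx : x ∈ CliffordAlgebra.even (cliffordForm n)) :
    clEven n x = clIncl n x := by
  have hx' : x ∈ CliffordAlgebra.evenOdd (cliffordForm n) 0 := hx
  clear hx
  induction x, hx' using CliffordAlgebra.even_induction with
  | algebraMap r => rw [AlgHom.commutes, AlgHom.commutes]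
  | add x y hx hy ihx ihy => rw [map_add, map_add, ihx, ihy]
  | ι_mul_ι_mul v w x hx ih =>
    rw [map_mul, map_mul, map_mul, ih, ← vec.eq_1, ← vec.eq_1, clEven_vec, clEven_vec,
      incl_mul_lastVec_mul_incl_mul_lastVec]

/-- The first `n - 1` factors form an even product, which is not changed; the last one, `eₙ`,
contributes `eₙ eₙ₊₁`. -/
theorem clEven_basisProd {n : ℕ} (hn : Odd n) : clEven n (basisProd n) = basisProd (n + 1) := by
  obtain ⟨m, rfl⟩ : ∃ m, n = m + 1 := ⟨n - 1, by have := hn.pos; omega⟩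
  have hm : Even m := by
    by_contra h
    exact Nat.not_even_iff_odd.2 hn (Nat.not_even_iff_odd.1 h).add_one
  rw [basisProd_succ (m + 1)]
  conv_lhs => rw [basisProd_succ, map_mul, clEven_eq_clIncl (clIncl_mem_even (basisProd_mem_even hm)),
    clEven_vec, ← mul_assoc, ← clIncl_vec, ← map_mul, ← basisProd_succ]

/-- The homomorphism `ℂ ⊗ Cl n → ℂ ⊗ Cl (n+1)`, `v ↦ v · eₙ₊₁`, onto the even part. -/
def cclEven (n : ℕ) : CCl n →ₐ[ℂ] CCl (n + 1) :=
  Algebra.TensorProduct.map (AlgHom.id ℂ ℂ) (clEven n)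

@[simp] theorem cclEven_tmul {n : ℕ} (z : ℂ) (x : Cl n) :
    cclEven n (z ⊗ₜ[ℝ] x) = z ⊗ₜ[ℝ] clEven n x := rfl

theorem cclEven_cvec {n : ℕ} (v : Eucl n) :
    cclEven n (cvec v) = cvec (incl n v) * cvec (lastVec n) := by
  rw [cclEven_tmul, clEven_vec, Algebra.TensorProduct.tmul_mul_tmul, one_mul]

theorem cclEven_volumeForm {n : ℕ} (hn : Odd n) :
    cclEven n (volumeForm n) = volumeForm (n + 1) := by
  obtain ⟨k, rfl⟩ := hn
  rw [volumeForm_eq, cclEven_tmul, clEven_basisProd ⟨k, rfl⟩, volumeForm_eq,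
    show (2 * k + 1 + 1 + 1) / 2 = (2 * k + 1 + 1) / 2 by omega]

/-- The image is generated by products of two vectors, each of which anticommutes with `ωₙ₊₁`
because `n + 1` is even. -/
theorem cclEven_mul_volumeForm {n : ℕ} (hn : Odd n) (a : CCl n) :
    cclEven n a * volumeForm (n + 1) = volumeForm (n + 1) * cclEven n a := by
  have ha : a ∈ Algebra.adjoin ℂ (Set.range (cvec (n := n))) := by
    rw [adjoin_range_cvec]; trivial
  induction ha using Algebra.adjoin_induction with
  | mem x hx =>
    obtain ⟨v, rfl⟩ := hx
    rw [cclEven_cvec]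
    exact mul_comm_of_anticomm (cvec_mul_volumeForm_of_even hn.add_one _)
      (cvec_mul_volumeForm_of_even hn.add_one _)
  | algebraMap r => rw [AlgHom.commutes, Algebra.commutes]
  | add x y _ _ hx hy => rw [map_add, add_mul, mul_add, hx, hy]
  | mul x y _ _ hx hy => rw [map_mul, mul_assoc, hy, ← mul_assoc, hx, mul_assoc]

/-! ### Restriction of spinor representations to the even part -/

section Restriction

variable {n : ℕ} {W : Type*} [AddCommGroup W] [Module ℂ W]

theorem apply_incl_eq (ρ : CCl (n + 1) →ₐ[ℂ] Module.End ℂ W) (v : Eucl n) (w : W) :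
    ρ (cvec (incl n v)) w = -ρ (cclEven n (cvec v)) (ρ (cvec (lastVec n)) w) := by
  rw [cclEven_cvec, map_mul, Module.End.mul_apply, cvec_apply_cvec_apply ρ (norm_lastVec n),
    map_neg, neg_neg]

/-- Since `v = -(v eₙ₊₁) eₙ₊₁`, the image of `cclEven` and `eₙ₊₁` together generate `ℂ ⊗ Cl (n+1)`.
-/
theorem apply_mem_of_cclEven_apply_mem {ρ : CCl (n + 1) →ₐ[ℂ] Module.End ℂ W} {p : Submodule ℂ W}
    (h : ∀ v, ∀ w ∈ p, ρ (cclEven n (cvec v)) w ∈ p) (h' : ∀ w ∈ p, ρ (cvec (lastVec n)) w ∈ p)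
    (a : CCl (n + 1)) {w : W} (hw : w ∈ p) : ρ a w ∈ p := by
  refine apply_mem_of_cvec_apply_mem (fun v w hw => ?_) a hw
  rw [cvec_incl_add_smul v, map_add, map_smul, LinearMap.add_apply, LinearMap.smul_apply,
    apply_incl_eq]
  exact p.add_mem (p.neg_mem (h _ _ (h' w hw))) (p.smul_mem _ (h' w hw))

/-- For `n` even, the spinor representation of `ℂ ⊗ Cl (n+1)` restricts to the one of its even part
`ℂ ⊗ Cl n`. -/
theorem IsSpinorRep.comp_cclEven (hn : Even n) {ρ : CCl (n + 1) →ₐ[ℂ] Module.End ℂ W}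
    (hρ : IsSpinorRep ρ) : IsSpinorRep (ρ.comp (cclEven n)) where
  nontrivial := hρ.nontrivial
  irreducible p hp := by
    refine hρ.irreducible p fun a w hw =>
      apply_mem_of_cclEven_apply_mem (fun v w hw => hp (cvec v) w hw) (fun w hw => ?_) a hw
    -- As `ωₙ₊₁ = 1`, `eₙ₊₁` acts as a multiple of `e₁ ⋯ eₙ`, which is even and so comes from
    -- `cclEven`. Invariance under `eₙ₊₁` is thus automatic.
    have h := congrArg ρ (volumeForm_mul_lastVec n)
    rw [map_mul, hρ.volume_eq_one hn.add_one, one_mul, cclIncl_tmul,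
      ← clEven_eq_clIncl (basisProd_mem_even hn), ← cclEven_tmul, map_neg, map_smul] at h
    rw [h]
    exact p.neg_mem (p.smul_mem _ (hp (1 ⊗ₜ basisProd n) w hw))
  volume_eq_one hn' := absurd hn (Nat.not_even_iff_odd.2 hn')

/-- The `+1`-eigenspace of the volume form. -/
def posSubmodule (ρ : CCl n →ₐ[ℂ] Module.End ℂ W) : Submodule ℂ W :=
  LinearMap.eqLocus (ρ (volumeForm n)) LinearMap.id

theorem mem_posSubmodule {ρ : CCl n →ₐ[ℂ] Module.End ℂ W} {w : W} :
    w ∈ posSubmodule ρ ↔ ρ (volumeForm n) w = w := Iff.rfl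

theorem cclEven_apply_mem_posSubmodule (hn : Odd n) {ρ : CCl (n + 1) →ₐ[ℂ] Module.End ℂ W}
    (a : CCl n) {w : W} (hw : w ∈ posSubmodule ρ) : ρ (cclEven n a) w ∈ posSubmodule ρ := by
  rw [mem_posSubmodule] at hw ⊢
  rw [← Module.End.mul_apply, ← map_mul, ← cclEven_mul_volumeForm hn, map_mul,
    Module.End.mul_apply, hw]

/-- For `n` odd, the representation of `ℂ ⊗ Cl n`, as the even part of `ℂ ⊗ Cl (n+1)`, on the
`+1`-eigenspace of the volume form. -/
def posRep (hn : Odd n) (ρ : CCl (n + 1) →ₐ[ℂ] Module.End ℂ W) :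
    CCl n →ₐ[ℂ] Module.End ℂ (posSubmodule ρ) where
  toFun a := (ρ (cclEven n a)).restrict fun _ hw => cclEven_apply_mem_posSubmodule hn a hw
  map_one' := by ext; simp
  map_mul' a b := by ext; simp
  map_zero' := by ext; simp
  map_add' a b := by ext; simp
  commutes' r := by
    ext w
    change ρ (cclEven n (algebraMap ℂ _ r)) w = r • (w : W)
    rw [AlgHom.commutes, AlgHom.commutes, Module.algebraMap_end_apply]

@[simp] theorem coe_posRep_apply (hn : Odd n) (ρ : CCl (n + 1) →ₐ[ℂ] Module.End ℂ W) (a : CCl n)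
    (w : posSubmodule ρ) : (posRep hn ρ a w : W) = ρ (cclEven n a) w := rfl

theorem volumeForm_apply_lastVec_apply (hn : Odd n) (ρ : CCl (n + 1) →ₐ[ℂ] Module.End ℂ W) (w : W) :
    ρ (volumeForm (n + 1)) (ρ (cvec (lastVec n)) w)
      = -ρ (cvec (lastVec n)) (ρ (volumeForm (n + 1)) w) := by
  rw [← Module.End.mul_apply, ← Module.End.mul_apply, ← map_mul, ← map_mul,
    cvec_mul_volumeForm_of_even hn.add_one, map_neg, LinearMap.neg_apply, neg_neg]

/-- `eₙ₊₁` anticommutes with `ωₙ₊₁` and so exchanges its two eigenspaces. If `q` is invariant in the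
positive one, then `q + eₙ₊₁ q` is invariant under all of `ℂ ⊗ Cl (n+1)`, hence `0` or everything,
and its positive part is `q`. -/
theorem IsSpinorRep.posRep (hn : Odd n) {ρ : CCl (n + 1) →ₐ[ℂ] Module.End ℂ W}
    (hρ : IsSpinorRep ρ) : IsSpinorRep (posRep hn ρ) where
  nontrivial := by
    have := hρ.nontrivial
    obtain ⟨w, hw⟩ := exists_ne (0 : W)
    -- `w + ω w` is positive as `ω² = 1`; if it vanishes, `w` is negative and `eₙ₊₁ w` is positive.
    by_cases h : w + ρ (volumeForm (n + 1)) w = 0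
    · refine ⟨⟨⟨ρ (cvec (lastVec n)) w, ?_⟩, 0, fun h0 => hw ?_⟩⟩
      · rw [mem_posSubmodule, volumeForm_apply_lastVec_apply hn, eq_neg_of_add_eq_zero_right h,
          map_neg, neg_neg]
      · have h1 : ρ (cvec (lastVec n)) w = 0 := congrArg Subtype.val h0
        have h2 := cvec_apply_cvec_apply ρ (norm_lastVec n) w
        rw [h1, map_zero] at h2
        exact neg_eq_zero.1 h2.symm
    · refine ⟨⟨⟨w + ρ (volumeForm (n + 1)) w, ?_⟩, 0, fun h0 => h (congrArg Subtype.val h0)⟩⟩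
      rw [mem_posSubmodule, map_add, ← Module.End.mul_apply, ← map_mul, volumeForm_mul_self, map_one,
        Module.End.one_apply, add_comm]
  irreducible q hq := by
    let p : Submodule ℂ W := q.map (posSubmodule ρ).subtype
    have hpos : ∀ w ∈ p, ρ (volumeForm (n + 1)) w = w := by
      rintro _ ⟨w, -, rfl⟩
      exact w.2
    have hp : ∀ v, ∀ w ∈ p, ρ (cclEven n (cvec v)) w ∈ p := by
      rintro v _ ⟨w, hw, rfl⟩
      exact ⟨_, hq (cvec v) w hw, rfl⟩
    have hee := cvec_apply_cvec_apply ρ (norm_lastVec n)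
    have hinv : ∀ a : CCl (n + 1), ∀ w ∈ p ⊔ p.map (ρ (cvec (lastVec n))),
        ρ a w ∈ p ⊔ p.map (ρ (cvec (lastVec n))) := fun a w hw => by
      refine apply_mem_of_cclEven_apply_mem (fun v w hw => ?_) (fun w hw => ?_) a hw
      · obtain ⟨x, hx, _, ⟨y, hy, rfl⟩, rfl⟩ := Submodule.mem_sup.1 hw
        have h : ρ (cclEven n (cvec v)) (ρ (cvec (lastVec n)) y)
            = -ρ (cvec (lastVec n)) (ρ (cclEven n (cvec v)) y) := by
          rw [cclEven_cvec, map_mul, Module.End.mul_apply, Module.End.mul_apply,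
            ← cvec_apply_cvec_apply_of_inner_eq_zero ρ (inner_incl_lastVec v)]
        rw [map_add, h]
        exact Submodule.add_mem_sup (hp v x hx)
          (neg_mem (Submodule.mem_map_of_mem (hp v y hy)))
      · obtain ⟨x, hx, _, ⟨y, hy, rfl⟩, rfl⟩ := Submodule.mem_sup.1 hw
        rw [map_add, hee, add_comm (ρ _ x)]
        exact Submodule.add_mem_sup (p.neg_mem hy) (Submodule.mem_map_of_mem hx)
    rcases hρ.irreducible _ hinv with h | h
    · left
      have h1 : p = ⊥ := le_bot_iff.1 (le_sup_left.trans h.le)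
      rw [eq_bot_iff]
      intro w hw
      have h2 : (w : W) ∈ p := ⟨w, hw, rfl⟩
      rw [h1, Submodule.mem_bot] at h2
      exact Subtype.ext h2
    · right
      rw [eq_top_iff]
      rintro ⟨w, hw⟩ -
      have hw' : w ∈ p ⊔ p.map (ρ (cvec (lastVec n))) := h ▸ Submodule.mem_top
      obtain ⟨x, hx, _, ⟨y, hy, rfl⟩, hxy⟩ := Submodule.mem_sup.1 hw'
      have h1 := mem_posSubmodule.1 hw
      rw [← hxy, map_add, hpos x hx, volumeForm_apply_lastVec_apply hn, hpos y hy,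
        add_right_inj] at h1
      have h2 : ρ (cvec (lastVec n)) y = 0 := eq_zero_of_neg_eq_self h1
      rw [h2, add_zero] at hxy
      subst hxy
      obtain ⟨z, hz, hzx⟩ := hx
      have : z = ⟨x, hw⟩ := Subtype.ext hzx
      rwa [← this]
  volume_eq_one _ := by
    ext w
    rw [coe_posRep_apply, cclEven_volumeForm hn]
    exact w.2

theorem spinIncl_tmul_eq_cclEven (g : Spin n) :
    (1 ⊗ₜ[ℝ] ((spinIncl n g : Spin (n + 1)) : Cl (n + 1)) : CCl (n + 1))
      = cclEven n (1 ⊗ₜ[ℝ] (g : Cl n)) := by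
  rw [cclEven_tmul, clEven_eq_clIncl (spinGroup.mem_even g.2)]
  rfl

theorem even_tmul_mul_volumeForm (hn : Even n) {x : Cl n}
    (hx : x ∈ CliffordAlgebra.even (cliffordForm n)) :
    (1 ⊗ₜ[ℝ] x : CCl n) * volumeForm n = volumeForm n * (1 ⊗ₜ[ℝ] x) := by
  have hx' : x ∈ CliffordAlgebra.evenOdd (cliffordForm n) 0 := hx
  clear hx
  induction x, hx' using CliffordAlgebra.even_induction with
  | algebraMap r =>
    rw [Algebra.algebraMap_eq_smul_one, TensorProduct.tmul_smul, smul_mul_assoc, mul_smul_comm,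
      ← Algebra.TensorProduct.one_def, one_mul, mul_one]
  | add x y hx hy ihx ihy => rw [TensorProduct.tmul_add, add_mul, mul_add, ihx, ihy]
  | ι_mul_ι_mul v w x hx ih =>
    have h : (1 ⊗ₜ[ℝ] (vec v * vec w * x) : CCl n) = cvec v * cvec w * (1 ⊗ₜ[ℝ] x) := by
      simp only [Algebra.TensorProduct.tmul_mul_tmul, one_mul]
    change (1 ⊗ₜ[ℝ] (vec v * vec w * x) : CCl n) * _ = _ * (1 ⊗ₜ[ℝ] (vec v * vec w * x))
    rw [h, mul_assoc, ih, ← mul_assoc, ← mul_assoc]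
    congr 1
    exact mul_comm_of_anticomm (cvec_mul_volumeForm_of_even hn _) (cvec_mul_volumeForm_of_even hn _)

end Restriction

end SpinGeom

end

noncomputable section

namespace SpinGeom

/-! ### Smooth maps into vector spaces -/

section SmoothOn

variable {n : ℕ} {M : Type*} [TopologicalSpace M] [ChartedSpace (Eucl n) M]
  {V V' V'' : Type*} [AddCommGroup V] [Module ℝ V] [AddCommGroup V'] [Module ℝ V']
  [AddCommGroup V''] [Module ℝ V'']

theorem SmoothOn.mono {F : M → V} {s t : Set M} (h : SmoothOn (n := n) F t) (hst : s ⊆ t) :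
    SmoothOn (n := n) F s := fun ℓ => (h ℓ).mono hst

theorem SmoothOn.congr {F G : M → V} {s : Set M} (h : SmoothOn (n := n) F s)
    (hFG : ∀ x ∈ s, G x = F x) : SmoothOn (n := n) G s := fun ℓ =>
  (h ℓ).congr fun x hx => by rw [hFG x hx]

theorem SmoothOn.linear {F : M → V} {s : Set M} (h : SmoothOn (n := n) F s) (L : V →ₗ[ℝ] V') :
    SmoothOn (n := n) (fun x => L (F x)) s := fun ℓ => h (ℓ ∘ₗ L)

/-- Expanding `F` in a finite basis leaves a finite sum of products of smooth scalar functions; `V'`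
may have any dimension. -/
theorem SmoothOn.bilinear [FiniteDimensional ℝ V] {F : M → V} {G : M → V'} {s : Set M}
    (hF : SmoothOn (n := n) F s) (hG : SmoothOn (n := n) G s) (B : V →ₗ[ℝ] V' →ₗ[ℝ] V'') :
    SmoothOn (n := n) (fun x => B (F x) (G x)) s := fun ℓ => by
  let b := Module.finBasis ℝ V
  have h : ∀ x, ℓ (B (F x) (G x)) = ∑ i, b.coord i (F x) * ℓ (B (b i) (G x)) := fun x => by
    conv_lhs => rw [← b.sum_repr (F x), map_sum, LinearMap.sum_apply, map_sum]
    exact Finset.sum_congr rfl fun i _ => by simp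
  simp only [h]
  intro x hx
  refine ContMDiffWithinAt.sum fun i _ => ?_
  exact ((hF (b.coord i)) x hx).mul ((hG (ℓ ∘ₗ B (b i))) x hx)

theorem smoothOn_of_locally {F : M → V} {s : Set M}
    (h : ∀ x ∈ s, ∃ u : Set M, IsOpen u ∧ x ∈ u ∧ SmoothOn (n := n) F (s ∩ u)) :
    SmoothOn (n := n) F s := fun ℓ => by
  refine contMDiffOn_of_locally_contMDiffOn fun x hx => ?_
  obtain ⟨u, hu, hxu, hF⟩ := h x hx
  exact ⟨u, hu, hxu, hF ℓ⟩

theorem SmoothOn.of_linear_injective {F : M → V} {s : Set M} {L : V →ₗ[ℝ] V'}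
    (hL : Function.Injective L) (h : SmoothOn (n := n) (fun x => L (F x)) s) :
    SmoothOn (n := n) F s := by
  obtain ⟨L', hL'⟩ := LinearMap.exists_leftInverse_of_injective L (LinearMap.ker_eq_bot.2 hL)
  refine (h.linear L').congr fun x _ => ?_
  exact (LinearMap.congr_fun hL' (F x)).symm

theorem contMDiffOn_iff_smoothOn {k : ℕ} {F : M → Eucl k} {s : Set M} :
    ContMDiffOn (𝓡 n) 𝓘(ℝ, Eucl k) ∞ F s ↔ SmoothOn (n := n) F s := by
  constructor
  · intro h ℓ
    exact (LinearMap.toContinuousLinearMap ℓ).contMDiff.comp_contMDiffOn h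
  · intro h
    have h1 : F = fun x => ∑ i, F x i • EuclideanSpace.single i (1 : ℝ) := by
      funext x; ext j; simp [Pi.single_apply]
    rw [h1]
    intro x hx
    refine ContMDiffWithinAt.sum fun i _ => ?_
    exact ContMDiffWithinAt.smul (h ((EuclideanSpace.proj i : Eucl k →L[ℝ] ℝ) : Eucl k →ₗ[ℝ] ℝ) x hx)
      contMDiffWithinAt_const

end SmoothOn

/-! ### Vector fields along maps -/

section VectorFields

variable {d m k : ℕ} {K M : Type*} [TopologicalSpace K] [ChartedSpace (Eucl d) K]
  [TopologicalSpace M] [ChartedSpace (Eucl m) M] [IsManifold (𝓡 m) ∞ M]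
  {f : K → M} {x : K}

theorem contMDiffAt_clm_of_apply {A : K → Eucl k →L[ℝ] Eucl m}
    (h : ∀ v, ContMDiffAt (𝓡 d) 𝓘(ℝ, Eucl m) ∞ (fun y => A y v) x) :
    ContMDiffAt (𝓡 d) 𝓘(ℝ, Eucl k →L[ℝ] Eucl m) ∞ A x := by
  have h1 : A = fun y => ∑ i : Fin k,
      ContinuousLinearMap.smulRightL ℝ (Eucl k) (Eucl m) (EuclideanSpace.proj i)
        (A y (EuclideanSpace.single i 1)) := by
    funext y
    ext1 v
    have hv : v = ∑ i, v i • EuclideanSpace.single i (1 : ℝ) := by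
      ext j; simp [Pi.single_apply]
    conv_lhs => rw [hv]
    simp
  rw [h1]
  refine ContMDiffAt.sum fun i _ => ?_
  exact (ContinuousLinearMap.contMDiff _).contMDiffAt.comp x (h _)

/-- With a left inverse `L` of `A x`, the endomorphism `L ∘ A y` is `1` at `x`, hence invertible
nearby with smooth inverse, and `u = (L A)⁻¹ L (A u)` there. -/
theorem contMDiffAt_of_comp_injective {A : K → Eucl k →L[ℝ] Eucl m} {u : K → Eucl k}
    (hA : ContMDiffAt (𝓡 d) 𝓘(ℝ, Eucl k →L[ℝ] Eucl m) ∞ A x) (hinj : Function.Injective (A x))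
    (hu : ContMDiffAt (𝓡 d) 𝓘(ℝ, Eucl m) ∞ (fun y => A y (u y)) x) :
    ContMDiffAt (𝓡 d) 𝓘(ℝ, Eucl k) ∞ u x := by
  obtain ⟨L₀, hL₀⟩ := LinearMap.exists_leftInverse_of_injective (A x : Eucl k →ₗ[ℝ] Eucl m)
    (LinearMap.ker_eq_bot.2 hinj)
  let L : Eucl m →L[ℝ] Eucl k := LinearMap.toContinuousLinearMap L₀
  have hLx : L.comp (A x) = 1 := by
    ext1 v
    exact LinearMap.congr_fun hL₀ v
  have hLA : ContMDiffAt (𝓡 d) 𝓘(ℝ, Eucl k →L[ℝ] Eucl k) ∞ (fun y => L.comp (A y)) x :=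
    contMDiffAt_const.clm_comp hA
  have hinv : ContMDiffAt (𝓡 d) 𝓘(ℝ, Eucl k →L[ℝ] Eucl k) ∞
      (fun y => Ring.inverse (L.comp (A y))) x := by
    have h1 : ContDiffAt ℝ ∞ (Ring.inverse (M₀ := Eucl k →L[ℝ] Eucl k)) (L.comp (A x)) := by
      rw [hLx]
      exact contDiffAt_ringInverse ℝ (1 : (Eucl k →L[ℝ] Eucl k)ˣ)
    exact ContMDiffAt.comp x h1.contMDiffAt hLA
  have hLu : ContMDiffAt (𝓡 d) 𝓘(ℝ, Eucl k) ∞ (fun y => L (A y (u y))) x :=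
    L.contMDiff.contMDiffAt.comp x hu
  refine (hinv.clm_apply hLu).congr_of_eventuallyEq ?_
  have hunit : ∀ᶠ y in nhds x, IsUnit (L.comp (A y)) := by
    refine hLA.continuousAt.eventually (p := fun T => IsUnit T) ?_
    change _ ∈ nhds (L.comp (A x))
    rw [hLx]
    exact Units.isOpen.mem_nhds isUnit_one
  filter_upwards [hunit] with y hy
  have := congrArg (fun T : Eucl k →L[ℝ] Eucl k => T (u y)) (Ring.inverse_mul_cancel _ hy)
  exact this.symm

/-- The coordinates in the canonical trivialization at `f x` of a linear family of vectors. -/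
def coordMap (f : K → M) (x : K) (B : ∀ y : K, Eucl k →ₗ[ℝ] TangentSpace (𝓡 m) (f y)) (y : K) :
    Eucl k →L[ℝ] Eucl m :=
  LinearMap.toContinuousLinearMap
    (((trivializationAt (Eucl m) (TangentSpace (𝓡 m)) (f x)).linearMapAt ℝ (f y)) ∘ₗ B y)

theorem eventually_coordMap_apply (hf : ContinuousAt f x)
    (B : ∀ y : K, Eucl k →ₗ[ℝ] TangentSpace (𝓡 m) (f y)) :
    ∀ᶠ y in nhds x, ∀ v, coordMap f x B y v =
      (trivializationAt (Eucl m) (TangentSpace (𝓡 m)) (f x) ⟨f y, B y v⟩).2 := by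
  have h := hf.eventually ((trivializationAt (Eucl m) (TangentSpace (𝓡 m)) (f x)).open_baseSet.mem_nhds
    (FiberBundle.mem_baseSet_trivializationAt' (f x)))
  filter_upwards [h] with y hy v
  change (trivializationAt (Eucl m) (TangentSpace (𝓡 m)) (f x)).linearMapAt ℝ (f y) (B y v) = _
  rw [Bundle.Trivialization.linearMapAt_apply]
  exact if_pos hy

theorem contMDiffAt_coordMap (hf : ContMDiffAt (𝓡 d) (𝓡 m) ∞ f x)
    {B : ∀ y : K, Eucl k →ₗ[ℝ] TangentSpace (𝓡 m) (f y)}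
    (hB : ∀ v, ContMDiffAt (𝓡 d) (𝓡 m).tangent ∞
      (fun y => (⟨f y, B y v⟩ : TangentBundle (𝓡 m) M)) x) :
    ContMDiffAt (𝓡 d) 𝓘(ℝ, Eucl k →L[ℝ] Eucl m) ∞ (coordMap f x B) x := by
  refine contMDiffAt_clm_of_apply fun v => ?_
  refine (contMDiffAt_totalSpace.1 (hB v)).2.congr_of_eventuallyEq ?_
  filter_upwards [eventually_coordMap_apply hf.continuousAt B] with y hy
  exact hy v

/-- The coefficients of a smooth vector field with respect to a smooth linearly independent family
of vector fields are smooth. -/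
theorem contMDiffAt_coeff (hf : ContMDiffAt (𝓡 d) (𝓡 m) ∞ f x)
    {B : ∀ y : K, Eucl k →ₗ[ℝ] TangentSpace (𝓡 m) (f y)}
    (hB : ∀ v, ContMDiffAt (𝓡 d) (𝓡 m).tangent ∞
      (fun y => (⟨f y, B y v⟩ : TangentBundle (𝓡 m) M)) x)
    (hinj : Function.Injective (B x)) {u : K → Eucl k}
    (hu : ContMDiffAt (𝓡 d) (𝓡 m).tangent ∞
      (fun y => (⟨f y, B y (u y)⟩ : TangentBundle (𝓡 m) M)) x) :
    ContMDiffAt (𝓡 d) 𝓘(ℝ, Eucl k) ∞ u x := by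
  refine contMDiffAt_of_comp_injective (contMDiffAt_coordMap hf hB) ?_ ?_
  · have h := FiberBundle.mem_baseSet_trivializationAt' (F := Eucl m) (E := TangentSpace (𝓡 m)) (f x)
    refine Function.Injective.comp (g := (trivializationAt (Eucl m) (TangentSpace (𝓡 m))
      (f x)).linearMapAt ℝ (f x)) ?_ hinj
    exact Function.LeftInverse.injective
      (fun v => Bundle.Trivialization.symmₗ_linearMapAt _ h v)
  · refine (contMDiffAt_totalSpace.1 hu).2.congr_of_eventuallyEq ?_
    filter_upwards [eventually_coordMap_apply hf.continuousAt B] with y hy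
    exact hy _

theorem contMDiffAt_linear_combination (hf : ContMDiffAt (𝓡 d) (𝓡 m) ∞ f x)
    {B : ∀ y : K, Eucl k →ₗ[ℝ] TangentSpace (𝓡 m) (f y)}
    (hB : ∀ v, ContMDiffAt (𝓡 d) (𝓡 m).tangent ∞
      (fun y => (⟨f y, B y v⟩ : TangentBundle (𝓡 m) M)) x)
    {u : K → Eucl k} (hu : ContMDiffAt (𝓡 d) 𝓘(ℝ, Eucl k) ∞ u x) :
    ContMDiffAt (𝓡 d) (𝓡 m).tangent ∞
      (fun y => (⟨f y, B y (u y)⟩ : TangentBundle (𝓡 m) M)) x := by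
  refine contMDiffAt_totalSpace.2 ⟨hf, ?_⟩
  refine ((contMDiffAt_coordMap hf hB).clm_apply hu).congr_of_eventuallyEq ?_
  filter_upwards [eventually_coordMap_apply hf.continuousAt B] with y hy
  exact (hy _).symm

variable [IsManifold (𝓡 d) ∞ K]

/-- A vector field is smooth if its image under an immersion is. -/
theorem contMDiffAt_of_mfderiv_apply (hf : ContMDiff (𝓡 d) (𝓡 m) ∞ f)
    (hinj : Function.Injective (mfderiv (𝓡 d) (𝓡 m) f x)) {X : ∀ y : K, TangentSpace (𝓡 d) y}
    (hX : ContMDiffAt (𝓡 d) (𝓡 m).tangent ∞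
      (fun y => (⟨f y, mfderiv (𝓡 d) (𝓡 m) f y (X y)⟩ : TangentBundle (𝓡 m) M)) x) :
    ContMDiffAt (𝓡 d) (𝓡 d).tangent ∞ (fun y => (⟨y, X y⟩ : TangentBundle (𝓡 d) K)) x := by
  let e := trivializationAt (Eucl d) (TangentSpace (𝓡 d) (M := K)) x
  have hx : x ∈ e.baseSet := FiberBundle.mem_baseSet_trivializationAt' x
  have hnear : ∀ᶠ y in nhds x, y ∈ e.baseSet := e.open_baseSet.mem_nhds hx
  let E : ∀ y : K, Eucl d →ₗ[ℝ] TangentSpace (𝓡 d) y := fun y => e.symmₗ ℝ y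
  have hE : ∀ v, ContMDiffAt (𝓡 d) (𝓡 d).tangent ∞
      (fun y => (⟨y, E y v⟩ : TangentBundle (𝓡 d) K)) x := fun v => by
    refine contMDiffAt_totalSpace.2 ⟨contMDiffAt_id, ?_⟩
    refine (contMDiffAt_const (c := v)).congr_of_eventuallyEq ?_
    filter_upwards [hnear] with y hy
    have h := e.linearMapAt_symmₗ (R := ℝ) hy v
    rwa [Bundle.Trivialization.linearMapAt_apply, if_pos hy] at h
  let u : K → Eucl d := fun y => (e ⟨y, X y⟩).2
  have hXu : ∀ᶠ y in nhds x, E y (u y) = X y := by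
    filter_upwards [hnear] with y hy
    have h := e.symmₗ_linearMapAt (R := ℝ) hy (X y)
    rwa [Bundle.Trivialization.linearMapAt_apply, if_pos hy] at h
  have hu : ContMDiffAt (𝓡 d) 𝓘(ℝ, Eucl d) ∞ u x := by
    -- The trivialization gives a smooth local frame `E`. As `f` is an immersion, `df ∘ E` is
    -- independent at `x`, and the coordinates of `X` are the coefficients of `df(X)` in it.
    refine contMDiffAt_coeff (B := fun y => (mfderiv (𝓡 d) (𝓡 m) f y).toLinearMap ∘ₗ E y)
      hf.contMDiffAt (fun v => ?_) ?_ ?_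
    · exact (hf.contMDiff_tangentMap le_rfl).contMDiffAt.comp x (hE v)
    · exact hinj.comp (Function.LeftInverse.injective fun v => e.linearMapAt_symmₗ (R := ℝ) hx v)
    · refine hX.congr_of_eventuallyEq ?_
      filter_upwards [hXu] with y hy
      change (⟨f y, mfderiv (𝓡 d) (𝓡 m) f y (E y (u y))⟩ : TangentBundle (𝓡 m) M) = _
      rw [hy]
  exact contMDiffAt_totalSpace.2 ⟨contMDiffAt_id, hu⟩

end VectorFields

end SpinGeom

end

noncomputable section

namespace SpinGeom

/-! ### Smooth maps into the spin group -/

section SmoothSpin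

variable {n k : ℕ} {K : Type*} [TopologicalSpace K] [ChartedSpace (Eucl k) K]

/-- The conjugation of the Clifford algebra as a linear map. -/
def clStar (n : ℕ) : Cl n →ₗ[ℝ] Cl n :=
  CliffordAlgebra.reverse ∘ₗ (CliffordAlgebra.involute (Q := cliffordForm n)).toLinearMap

theorem SmoothOn.mul {F G : K → Cl n} {s : Set K} (hF : SmoothOn (n := k) F s)
    (hG : SmoothOn (n := k) G s) : SmoothOn (n := k) (fun y => F y * G y) s :=
  hF.bilinear hG (LinearMap.mul ℝ (Cl n))

theorem SmoothOn.const {V : Type*} [AddCommGroup V] [Module ℝ V] (v : V) (s : Set K) :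
    SmoothOn (n := k) (fun _ : K => v) s := fun _ => contMDiffOn_const

theorem SmoothOn.spin_inv {γ : K → Spin n} {s : Set K}
    (h : SmoothOn (n := k) (fun y => (γ y : Cl n)) s) :
    SmoothOn (n := k) (fun y => (((γ y)⁻¹ : Spin n) : Cl n)) s :=
  h.linear (clStar n)

theorem SmoothOn.Ad {γ : K → Spin n} {s : Set K}
    (h : SmoothOn (n := k) (fun y => (γ y : Cl n)) s) (v : Eucl n) :
    SmoothOn (n := k) (fun y => Ad (γ y) v) s := by
  refine SmoothOn.of_linear_injective (L := CliffordAlgebra.ι (cliffordForm n)) (vec_injective n) ?_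
  exact ((h.mul (SmoothOn.const (vec v) s)).mul h.spin_inv).congr fun y _ => vec_Ad _ _

theorem SmoothOn.comp_contMDiff {m : ℕ} {M : Type*} [TopologicalSpace M] [ChartedSpace (Eucl m) M]
    {V : Type*} [AddCommGroup V] [Module ℝ V] {F : M → V} {s : Set M}
    (hF : SmoothOn (n := m) F s) {f : K → M} (hf : ContMDiff (𝓡 k) (𝓡 m) ∞ f) :
    SmoothOn (n := k) (fun y => F (f y)) (f ⁻¹' s) := fun ℓ =>
  (hF ℓ).comp hf.contMDiffOn fun _ hy => hy

theorem smoothOn_rotor {u₀ : Eucl n} (h₀ : ‖u₀‖ = 1) {u : K → Eucl n} {s : Set K}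
    (hu : ContMDiffOn (𝓡 k) 𝓘(ℝ, Eucl n) ∞ u s) (hs : ∀ y ∈ s, u y + u₀ ≠ 0) :
    SmoothOn (n := k) (fun y => (rotor u₀ (u y) : Cl n)) s := by
  have hadd : ContMDiffOn (𝓡 k) 𝓘(ℝ, Eucl n) ∞ (fun y => u y + u₀) s :=
    hu.add contMDiffOn_const
  have hinv : ContMDiffOn (𝓡 k) 𝓘(ℝ, ℝ) ∞ (fun y => ‖u y + u₀‖⁻¹) s := fun y hy => by
    have h1 : ContDiffAt ℝ ∞ (fun v : Eucl n => ‖v‖⁻¹) (u y + u₀) :=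
      (contDiffAt_norm ℝ (hs y hy)).inv (norm_ne_zero_iff.2 (hs y hy))
    exact ContMDiffAt.comp_contMDiffWithinAt (g := fun v : Eucl n => ‖v‖⁻¹) y h1.contMDiffAt
      (hadd y hy)
  have hsm : ContMDiffOn (𝓡 k) 𝓘(ℝ, Eucl n) ∞ (fun y => ‖u y + u₀‖⁻¹ • (u y + u₀)) s :=
    hinv.smul hadd
  refine ((contMDiffOn_iff_smoothOn.1 hsm).linear ((LinearMap.mulRight ℝ (vec u₀)).comp
    (CliffordAlgebra.ι (cliffordForm n)))).congr fun y hy => ?_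
  rw [coe_rotor h₀ (hs y hy), ← smul_mul_assoc, ← vec_smul]
  rfl

variable {W : Type*} [AddCommGroup W] [Module ℂ W]

/-- The action of the real Clifford algebra on a complex representation. -/
def clAction (ρ : CCl n →ₐ[ℂ] Module.End ℂ W) : Cl n →ₗ[ℝ] W →ₗ[ℝ] W :=
  LinearMap.mk₂ ℝ (fun x w => ρ (1 ⊗ₜ[ℝ] x) w)
    (fun x y w => by rw [TensorProduct.tmul_add, map_add, LinearMap.add_apply])
    (fun c x w => by
      have h : (1 ⊗ₜ[ℝ] (c • x) : CCl n) = (c : ℂ) • (1 ⊗ₜ[ℝ] x) := by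
        rw [TensorProduct.tmul_smul]; rfl
      rw [h, map_smul]; rfl)
    (fun x v w => map_add _ v w)
    (fun c x w => by
      rw [← Complex.coe_smul, ← Complex.coe_smul, map_smul])

theorem SmoothOn.clAction {F : K → Cl n} {w : K → W} {s : Set K} (hF : SmoothOn (n := k) F s)
    (hw : SmoothOn (n := k) w s) (ρ : CCl n →ₐ[ℂ] Module.End ℂ W) :
    SmoothOn (n := k) (fun y => ρ (1 ⊗ₜ[ℝ] F y) (w y)) s :=
  hF.bilinear hw (SpinGeom.clAction ρ)

end SmoothSpin

/-! ### Spinors and their values at spin frames -/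

namespace SpinFrames

section Eval

variable {n : ℕ} {M : Type*} [TopologicalSpace M] [ChartedSpace (Eucl n) M]
  [IsManifold (𝓡 n) ∞ M] {G : OrientedRiemannian n M} {P : SpinFrames G}
  {W : Type*} [AddCommGroup W] [Module ℂ W]

theorem IsSpinStructure.act_injective (hP : P.IsSpinStructure) {x : M} (p : P.Fiber x) :
    Function.Injective (P.act p) := fun g h hgh => by
  have h1 : P.act p (g * h⁻¹) = p := by
    rw [P.act_mul, hgh, ← P.act_mul, mul_inv_cancel, P.act_one]
  exact mul_inv_eq_one.1 (hP.free p _ h1)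

theorem IsSpinStructure.nonempty_fiber (hP : P.IsSpinStructure) (x : M) : Nonempty (P.Fiber x) := by
  obtain ⟨c, -, -⟩ := hP.covers x
  exact ⟨c.2 x⟩

theorem spinor_act {ρ : CCl n →ₐ[ℂ] Module.End ℂ W} {x : M} (φ : P.Spinor ρ x) (p : P.Fiber x)
    (g : Spin n) : φ.1 (P.act p g) = ρ (1 ⊗ₜ[ℝ] ((g⁻¹ : Spin n) : Cl n)) (φ.1 p) := φ.2 p g

theorem spinor_eq_apply_act {ρ : CCl n →ₐ[ℂ] Module.End ℂ W} {x : M} (φ : P.Spinor ρ x)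
    (p : P.Fiber x) (g : Spin n) :
    φ.1 p = ρ (1 ⊗ₜ[ℝ] (g : Cl n)) (φ.1 (P.act p g)) := by
  rw [spinor_act, ← Module.End.mul_apply, ← map_mul, Algebra.TensorProduct.tmul_mul_tmul, one_mul,
    spin_mul_inv, ← Algebra.TensorProduct.one_def, map_one, Module.End.one_apply]

theorem IsSpinStructure.spinor_ext (hP : P.IsSpinStructure) {ρ : CCl n →ₐ[ℂ] Module.End ℂ W} {x : M}
    {φ ψ : P.Spinor ρ x} (p : P.Fiber x) (h : φ.1 p = ψ.1 p) : φ = ψ := by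
  apply Subtype.ext
  funext q
  obtain ⟨g, rfl⟩ := hP.transitive p q
  rw [spinor_act, spinor_act, h]

/-- The value at `p` is spread over the fibre by equivariance; freeness of the action makes this
consistent. -/
theorem IsSpinStructure.exists_spinor (hP : P.IsSpinStructure) (ρ : CCl n →ₐ[ℂ] Module.End ℂ W)
    {x : M} (p : P.Fiber x) (w : W) : ∃ φ : P.Spinor ρ x, φ.1 p = w := by
  choose g hg using hP.transitive p
  refine ⟨⟨fun q => ρ (1 ⊗ₜ[ℝ] (((g q)⁻¹ : Spin n) : Cl n)) w, fun q h => ?_⟩, ?_⟩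
  · have h1 : g (P.act q h) = g q * h :=
      hP.act_injective p (by rw [hg, P.act_mul, hg])
    beta_reduce
    rw [h1, mul_inv_rev, ← Module.End.mul_apply, ← map_mul, Algebra.TensorProduct.tmul_mul_tmul,
      one_mul]
    rfl
  · have h1 : g p = 1 := hP.free p _ (hg p)
    change ρ (1 ⊗ₜ[ℝ] (((g p)⁻¹ : Spin n) : Cl n)) w = w
    rw [h1, inv_one, Submonoid.coe_one, ← Algebra.TensorProduct.one_def, map_one,
      Module.End.one_apply]

/-- The identification `σ ↦ [p, σ]` of the spinor module with a fibre of the spinor bundle. -/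
def IsSpinStructure.evalEquiv (hP : P.IsSpinStructure) (ρ : CCl n →ₐ[ℂ] Module.End ℂ W) {x : M}
    (p : P.Fiber x) : P.Spinor ρ x ≃ₗ[ℂ] W :=
  LinearEquiv.ofBijective
    { toFun := fun φ => φ.1 p
      map_add' := fun _ _ => rfl
      map_smul' := fun _ _ => rfl }
    ⟨fun _ _ h => hP.spinor_ext p h, fun w => hP.exists_spinor ρ p w⟩

theorem IsSpinStructure.mem_posSpinor_iff (hn : Even n) (hP : P.IsSpinStructure)
    {ρ : CCl n →ₐ[ℂ] Module.End ℂ W} {x : M} (p : P.Fiber x) {φ : P.Spinor ρ x} :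
    φ ∈ P.PosSpinor ρ x ↔ φ.1 p ∈ posSubmodule ρ := by
  refine ⟨fun h => h p, fun h q => ?_⟩
  obtain ⟨g, rfl⟩ := hP.transitive p q
  rw [mem_posSubmodule] at h
  rw [spinor_act, ← Module.End.mul_apply, ← map_mul,
    ← even_tmul_mul_volumeForm hn (spinGroup.mem_even (g⁻¹).2), map_mul, Module.End.mul_apply, h]

/-- The identification `σ ↦ [p, σ]` for the positive spinors. -/
def IsSpinStructure.evalPosEquiv (hn : Even n) (hP : P.IsSpinStructure)
    (ρ : CCl n →ₐ[ℂ] Module.End ℂ W) {x : M} (p : P.Fiber x) :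
    P.PosSpinor ρ x ≃ₗ[ℂ] posSubmodule ρ :=
  LinearEquiv.ofBijective
    { toFun := fun φ => ⟨φ.1.1 p, φ.2 p⟩
      map_add' := fun _ _ => rfl
      map_smul' := fun _ _ => rfl }
    ⟨fun _ _ h => Subtype.ext (hP.spinor_ext p (congrArg Subtype.val h)), fun w => by
      obtain ⟨φ, hφ⟩ := hP.exists_spinor ρ p w.1
      exact ⟨⟨φ, (hP.mem_posSpinor_iff hn p).2 (hφ ▸ w.2)⟩, Subtype.ext hφ⟩⟩

/-- Relative to an atlas section `t`, `s = t γ₁` and `s' = t γ₂` with smooth `γ₁, γ₂`, so `γ = γ₂⁻¹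
γ₁` by freeness. -/
theorem SmoothLift.smoothOn_of_act (hP : P.IsSpinStructure) {k : ℕ} {K : Type*}
    [TopologicalSpace K] [ChartedSpace (Eucl k) K] {f : K → M} (hf : Continuous f) {U U' : Set K}
    {s s' : ∀ y : K, P.Fiber (f y)} (h : P.SmoothLift (k := k) f U s)
    (h' : P.SmoothLift (k := k) f U' s') {γ : K → Spin n}
    (hγ : ∀ y ∈ U ∩ U', s y = P.act (s' y) (γ y)) :
    SmoothOn (n := k) (fun y => (γ y : Cl n)) (U ∩ U') := by
  refine smoothOn_of_locally fun y _ => ?_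
  obtain ⟨c, hc, hyc⟩ := hP.covers (f y)
  obtain ⟨γ₁, h₁, hs₁⟩ := h c hc
  obtain ⟨γ₂, h₂, hs₂⟩ := h' c hc
  refine ⟨f ⁻¹' (c.1 : Set M), c.1.isOpen.preimage hf, hyc, ?_⟩
  refine SmoothOn.congr (F := fun y => (((γ₂ y)⁻¹ * γ₁ y : Spin n) : Cl n)) ?_ fun z hz => ?_
  · exact (hs₂.mono fun z hz => ⟨hz.1.2, hz.2⟩).spin_inv.mul (hs₁.mono fun z hz => ⟨hz.1.1, hz.2⟩)
  · have h3 := hγ z hz.1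
    rw [h₁ z ⟨hz.1.1, hz.2⟩, h₂ z ⟨hz.1.2, hz.2⟩, ← P.act_mul] at h3
    rw [hP.act_injective _ h3, inv_mul_cancel_left]

end Eval

end SpinFrames

end SpinGeom

end

noncomputable section

namespace SpinGeom

/-! ### The induced spin structure of a hypersurface -/

namespace OrientedHypersurface

variable {n : ℕ} {M : Type*} [TopologicalSpace M] [ChartedSpace (Eucl n) M]
  [IsManifold (𝓡 n) ∞ M]
  {N : Type*} [TopologicalSpace N] [ChartedSpace (Eucl (n + 1)) N]
  [IsManifold (𝓡 (n + 1)) ∞ N] {GM : OrientedRiemannian n M} {GN : OrientedRiemannian (n + 1) N}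

theorem push_injective (H : OrientedHypersurface GM GN) (x : M) :
    Function.Injective (fun X : TangentSpace (𝓡 n) x => H.push X) := by
  refine (injective_iff_map_eq_zero (mfderiv (𝓡 n) (𝓡 (n + 1)) H.f x)).2 fun X hX => ?_
  by_contra h
  have h1 := H.isometric x X X
  rw [hX, map_zero] at h1
  exact (GM.metric.pos x X h).ne h1

theorem isAdapted_unique (H : OrientedHypersurface GM GN) {x : M} {e₁ e₂ : SOFrame GM x}
    {e' : SOFrame GN (H.f x)} (h₁ : H.IsAdapted e₁ e') (h₂ : H.IsAdapted e₂ e') : e₁ = e₂ :=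
  SOFrame.ext' fun v => H.push_injective x ((h₁.1 v).symm.trans (h₂.1 v))

/-- In the frame `e'` the image of `df` is orthogonal to `eₙ₊₁`, so the coordinates of `df` give an
injective map from `T_xM` to `ℝⁿ`. By dimension it is invertible, and its inverse is the frame `e`.
-/
theorem exists_isAdapted (H : OrientedHypersurface GM GN) {x : M} (e' : SOFrame GN (H.f x))
    (he' : e'.toEquiv (lastVec n) = H.ν x) : ∃ e : SOFrame GM x, H.IsAdapted e e' := by
  have : FiniteDimensional ℝ (TangentSpace (𝓡 n) x) :=
    inferInstanceAs (FiniteDimensional ℝ (Eucl n))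
  let D : TangentSpace (𝓡 n) x →ₗ[ℝ] Eucl (n + 1) :=
    e'.toEquiv.symm.toLinearMap ∘ₗ (mfderiv (𝓡 n) (𝓡 (n + 1)) H.f x).toLinearMap
  have hD : ∀ X, e'.toEquiv (D X) = H.push X := fun X => e'.toEquiv.apply_symm_apply _
  have hDincl : ∀ X, incl n (dropLast n (D X)) = D X := fun X => by
    apply incl_dropLast_of_inner_eq_zero
    rw [← e'.orthonormal, hD, he']
    exact H.ν_normal x X
  have hinj : Function.Injective (dropLast n ∘ₗ D) := fun X Y h => by
    apply H.push_injective x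
    change H.push X = H.push Y
    rw [← hD, ← hD, ← hDincl X, ← hDincl Y]
    exact congrArg (fun v => e'.toEquiv (incl n v)) h
  let e : Eucl n ≃ₗ[ℝ] TangentSpace (𝓡 n) x :=
    (LinearMap.linearEquivOfInjective (dropLast n ∘ₗ D) hinj rfl).symm
  have he : ∀ v, e'.toEquiv (incl n v) = H.push (e v) := fun v => by
    rw [← hD, ← hDincl]
    have h : (dropLast n ∘ₗ D) (e v) = v :=
      (LinearMap.linearEquivOfInjective (dropLast n ∘ₗ D) hinj rfl).apply_symm_apply v
    exact congrArg (fun v => e'.toEquiv (incl n v)) h.symm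
  refine ⟨⟨e, fun v w => ?_, ?_⟩, he, he'⟩
  · rw [← H.isometric, ← inner_incl, ← e'.orthonormal, he, he]
    rfl
  · exact (H.oriented x e e'.toEquiv he he').2 e'.oriented

variable (H : OrientedHypersurface GM GN) {P : SpinFrames GN}

/-- As `df` is injective, `p` determines `e`; points of the induced bundle can be compared in `P`.
-/
theorem inducedSpin_fiber_ext {x : M} {q q' : (H.inducedSpin P).Fiber x} (h : q.1.2 = q'.1.2) :
    q = q' :=
  Subtype.ext (Prod.ext (H.isAdapted_unique q.2 (h ▸ q'.2)) h)

theorem exists_inducedSpin_fiber {x : M} (p : P.Fiber (H.f x))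
    (hp : (P.proj p).toEquiv (lastVec n) = H.ν x) : ∃ q : (H.inducedSpin P).Fiber x, q.1.2 = p := by
  obtain ⟨e, he⟩ := H.exists_isAdapted (P.proj p) hp
  exact ⟨⟨(e, p), he⟩, rfl⟩

theorem norm_symm_ν {x : M} (e' : SOFrame GN (H.f x)) : ‖e'.toEquiv.symm (H.ν x)‖ = 1 := by
  have h := e'.orthonormal (e'.toEquiv.symm (H.ν x)) (e'.toEquiv.symm (H.ν x))
  rw [LinearEquiv.apply_symm_apply, H.ν_unit, real_inner_self_eq_norm_sq] at h
  exact (pow_eq_one_iff_of_nonneg (norm_nonneg _) two_ne_zero).1 h.symm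

theorem proj_act_lastVec {x : M} {p : P.Fiber (H.f x)} {g : Spin (n + 1)}
    (hg : Ad g (lastVec n) = (P.proj p).toEquiv.symm (H.ν x)) :
    (P.proj (P.act p g)).toEquiv (lastVec n) = H.ν x := by
  rw [P.proj_act, hg, LinearEquiv.apply_symm_apply]

theorem nonempty_inducedSpin_fiber (hn : 1 ≤ n) (hP : P.IsSpinStructure) (x : M) :
    Nonempty ((H.inducedSpin P).Fiber x) := by
  obtain ⟨p⟩ := hP.nonempty_fiber (H.f x)
  obtain ⟨g, hg⟩ := exists_Ad_lastVec_eq hn (H.norm_symm_ν (P.proj p))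
  obtain ⟨q, -⟩ := H.exists_inducedSpin_fiber (P.act p g) (H.proj_act_lastVec hg)
  exact ⟨q⟩

/-- The `h` that takes one second component to the other fixes `eₙ₊₁`, since both frames send `eₙ₊₁`
to `ν`. So `h` comes from `Spin(n)`. -/
theorem inducedSpin_transitive (hn : 1 ≤ n) (hP : P.IsSpinStructure) {x : M}
    (q q' : (H.inducedSpin P).Fiber x) : ∃ g : Spin n, (H.inducedSpin P).act q g = q' := by
  obtain ⟨h, hh⟩ := hP.transitive q.1.2 q'.1.2
  have hlast : Ad h (lastVec n) = lastVec n := by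
    apply (P.proj q.1.2).toEquiv.injective
    rw [← P.proj_act, hh, q'.2.2, q.2.2]
  obtain ⟨g, rfl⟩ := exists_spinIncl_eq hn hlast
  exact ⟨g, H.inducedSpin_fiber_ext hh⟩

theorem inducedSpin_free (hP : P.IsSpinStructure) {x : M} (q : (H.inducedSpin P).Fiber x)
    (g : Spin n) (h : (H.inducedSpin P).act q g = q) : g = 1 := by
  have h1 : P.act q.1.2 (spinIncl n g) = q.1.2 := congrArg (fun q => q.1.2) h
  exact spinIncl_injective n ((hP.free _ _ h1).trans (map_one _).symm)

theorem contMDiffAt_proj_comp (hP : P.IsSpinStructure) {c : Opens N × (∀ x : N, P.Fiber x)}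
    (hc : c ∈ P.atlas) {x : M} (hx : H.f x ∈ c.1) (v : Eucl (n + 1)) :
    ContMDiffAt (𝓡 n) (𝓡 (n + 1)).tangent ∞
      (fun y => (⟨H.f y, (P.proj (c.2 (H.f y))).toEquiv v⟩ : TangentBundle (𝓡 (n + 1)) N)) x :=
  ((hP.proj_smooth c hc v).contMDiffAt (c.1.isOpen.mem_nhds hx)).comp x H.smooth.contMDiffAt

/-- A local section of `P` is pulled back along `f` and rotated until its last vector is `ν`. If `u`
denotes the coordinates of `ν`, a fixed `g₀` takes `eₙ₊₁` to `u x`, and the rotor takes `u x`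
smoothly to `u y`. -/
theorem exists_inducedSpin_section (hn : 1 ≤ n) (hP : P.IsSpinStructure) (x : M) :
    ∃ c ∈ (H.inducedSpin P).atlas, x ∈ c.1 := by
  obtain ⟨c, hc, hxc⟩ := hP.covers (H.f x)
  let u : M → Eucl (n + 1) := fun y => (P.proj (c.2 (H.f y))).toEquiv.symm (H.ν y)
  have hu1 : ∀ y, ‖u y‖ = 1 := fun y => H.norm_symm_ν _
  have hV : IsOpen (H.f ⁻¹' (c.1 : Set N)) := c.1.isOpen.preimage H.smooth.continuous
  have hu : ContMDiffOn (𝓡 n) 𝓘(ℝ, Eucl (n + 1)) ∞ u (H.f ⁻¹' (c.1 : Set N)) := fun y hy => by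
    refine (contMDiffAt_coeff (B := fun z => (P.proj (c.2 (H.f z))).toEquiv.toLinearMap)
      H.smooth.contMDiffAt (fun v => H.contMDiffAt_proj_comp hP hc hy v)
      (P.proj (c.2 (H.f y))).toEquiv.injective ?_).contMDiffWithinAt
    refine (H.ν_smooth.contMDiffAt (x := y)).congr_of_eventuallyEq (Filter.Eventually.of_forall ?_)
    intro z
    change (⟨H.f z, (P.proj (c.2 (H.f z))).toEquiv (u z)⟩ : TangentBundle (𝓡 (n + 1)) N) = _
    rw [LinearEquiv.apply_symm_apply]
  -- The antipode of `u x` is excluded, where the rotor degenerates.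
  let U : Opens M := ⟨H.f ⁻¹' (c.1 : Set N) ∩ u ⁻¹' {v | v + u x ≠ 0},
    hu.continuousOn.isOpen_inter_preimage hV
      (isOpen_ne.preimage (continuous_id.add continuous_const))⟩
  have hxU : x ∈ U := by
    refine ⟨hxc, fun h => ?_⟩
    have h0 : u x = 0 := eq_zero_of_neg_eq_self (eq_neg_of_add_eq_zero_left h).symm
    have h1 := hu1 x
    rw [h0, norm_zero] at h1
    exact zero_ne_one h1
  obtain ⟨g₀, hg₀⟩ := exists_Ad_lastVec_eq hn (hu1 x)
  let γ : M → Spin (n + 1) := fun y => rotor (u x) (u y) * g₀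
  have hγ : SmoothOn (n := n) (fun y => (γ y : Cl (n + 1))) (U : Set M) :=
    (smoothOn_rotor (hu1 x) (hu.mono fun y hy => hy.1) fun y hy => hy.2).mul (SmoothOn.const _ _)
  have hAd : ∀ y ∈ U, Ad (γ y) (lastVec n) = u y := fun y hy => by
    rw [Ad_mul, hg₀, Ad_rotor (hu1 x) (hu1 y) hy.2]
  -- Sections in the atlas are functions on all of `M`; outside `U` any value will do.
  have hs : ∀ y, ∃ q : (H.inducedSpin P).Fiber y, y ∈ U → q.1.2 = P.act (c.2 (H.f y)) (γ y) :=
    fun y => by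
      by_cases hy : y ∈ U
      · obtain ⟨q, hq⟩ := H.exists_inducedSpin_fiber _ (H.proj_act_lastVec (hAd y hy))
        exact ⟨q, fun _ => hq⟩
      · obtain ⟨q⟩ := H.nonempty_inducedSpin_fiber hn hP y
        exact ⟨q, fun h => absurd h hy⟩
  choose s hs using hs
  refine ⟨(U, s), ⟨fun v y hy => ?_, fun c' hc' => ?_⟩, hxU⟩
  · have hUy : (U : Set M) ∈ nhds y := U.isOpen.mem_nhds hy
    refine (contMDiffAt_of_mfderiv_apply H.smooth (H.push_injective y) ?_).contMDiffWithinAt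
    refine (contMDiffAt_linear_combination
      (B := fun z => (P.proj (c.2 (H.f z))).toEquiv.toLinearMap) H.smooth.contMDiffAt
      (fun w => H.contMDiffAt_proj_comp hP hc hy.1 w)
      ((contMDiffOn_iff_smoothOn.2 (hγ.Ad (incl n v))).contMDiffAt hUy)).congr_of_eventuallyEq ?_
    filter_upwards [hUy] with z hz
    have h1 := (s z).2.1 v
    rw [hs z hz, P.proj_act] at h1
    change (⟨H.f z, H.push ((s z).1.1.toEquiv v)⟩ : TangentBundle (𝓡 (n + 1)) N)
      = ⟨H.f z, (P.proj (c.2 (H.f z))).toEquiv (Ad (γ z) (incl n v))⟩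
    rw [h1]
  · obtain ⟨δ, hδ, hδs⟩ := hP.compatible c hc c' hc'
    refine ⟨fun y => δ (H.f y) * γ y, fun y hy => ?_, ?_⟩
    · refine (hs y hy.1).trans ?_
      exact (congrArg (fun p => P.act p (γ y)) (hδ (H.f y) ⟨hy.1.1, hy.2⟩)).trans
        (P.act_mul _ _ _).symm
    · exact ((hδs.comp_contMDiff H.smooth).mono fun y hy => ⟨hy.1.1, hy.2⟩).mul
        (hγ.mono fun y hy => hy.1)

/-- The pull-back of a spin structure to an oriented hypersurface is a spin structure. -/
theorem isSpinStructure_inducedSpin (hn : 1 ≤ n) (hP : P.IsSpinStructure) :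
    (H.inducedSpin P).IsSpinStructure where
  free q g h := H.inducedSpin_free hP q g h
  transitive q q' := H.inducedSpin_transitive hn hP q q'
  covers x := H.exists_inducedSpin_section hn hP x
  compatible c hc c' hc' := by
    choose γ hγ using fun y => H.inducedSpin_transitive hn hP (c'.2 y) (c.2 y)
    refine ⟨γ, fun y _ => (hγ y).symm, ?_⟩
    -- Smoothness may be tested in `Cl (n+1)`, where `γ` becomes the transition function of the
    -- second components, two smooth lifts of `f` to `P`.
    refine SmoothOn.of_linear_injective (L := (clIncl n).toLinearMap) (clIncl_injective n) ?_
    exact SpinFrames.SmoothLift.smoothOn_of_act (γ := fun y => spinIncl n (γ y)) hP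
      H.smooth.continuous hc.2 hc'.2 fun y _ => congrArg (fun q => q.1.2) (hγ y).symm
  proj_smooth c hc v := hc.1 v

/-! ### Comparison of the spinor bundles -/

section Spinors

variable {W : Type*} [AddCommGroup W] [Module ℂ W] {W' : Type*} [AddCommGroup W'] [Module ℂ W']
  {ρ : CCl n →ₐ[ℂ] Module.End ℂ W} {ρ' : CCl (n + 1) →ₐ[ℂ] Module.End ℂ W'}

theorem inducedSpin_act_snd {x : M} (q : (H.inducedSpin P).Fiber x) (g : Spin n) :
    ((H.inducedSpin P).act q g).1.2 = P.act q.1.2 (spinIncl n g) := rfl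

/-- An equivariant map `R` of the spinor modules turns spinors of the ambient manifold along the
hypersurface into spinors of the hypersurface. -/
theorem apply_eq_of_apply_eq (hn : 1 ≤ n) (hP : P.IsSpinStructure) {x : M} {R : W' →ₗ[ℂ] W}
    {φ : P.Spinor ρ' (H.f x)} {ψ : (H.inducedSpin P).Spinor ρ x}
    (hR : ∀ (p : P.Fiber (H.f x)) (a : CCl n), R (ρ' (cclEven n a) (φ.1 p)) = ρ a (R (φ.1 p)))
    {q : (H.inducedSpin P).Fiber x} (hq : ψ.1 q = R (φ.1 q.1.2)) (q' : (H.inducedSpin P).Fiber x) :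
    ψ.1 q' = R (φ.1 q'.1.2) := by
  obtain ⟨g, rfl⟩ := H.inducedSpin_transitive hn hP q q'
  rw [SpinFrames.spinor_act, inducedSpin_act_snd, SpinFrames.spinor_act, ← map_inv,
    spinIncl_tmul_eq_cclEven, hR, hq]

/-- Along `f`, the second component of an induced section and a section of the atlas of `P` differ
by a smooth map into `Spin(n+1)`. Smoothness of values therefore passes from one to the other, with
`R` and `S` translating between the two modules. -/
theorem smoothSpinor_iff (hn : 1 ≤ n) (hP : P.IsSpinStructure) {R : W' →ₗ[ℂ] W} {S : W →ₗ[ℂ] W'}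
    {φ : ∀ x : M, P.Spinor ρ' (H.f x)} {ψ : ∀ x : M, (H.inducedSpin P).Spinor ρ x}
    (hR : ∀ x (q : (H.inducedSpin P).Fiber x), (ψ x).1 q = R ((φ x).1 q.1.2))
    (hS : ∀ x (q : (H.inducedSpin P).Fiber x), (φ x).1 q.1.2 = S ((ψ x).1 q)) (U : Opens M) :
    P.SmoothSpinor (k := n) ρ' H.f U φ ↔
      (H.inducedSpin P).SmoothSpinor (k := n) ρ (fun x : M => x) U ψ := by
  constructor
  · intro h c hc
    refine smoothOn_of_locally fun y hy => ?_
    obtain ⟨c₀, hc₀, hyc⟩ := hP.covers (H.f y)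
    obtain ⟨γ, hγ, hγs⟩ := hc.2 c₀ hc₀
    refine ⟨H.f ⁻¹' (c₀.1 : Set N), c₀.1.isOpen.preimage H.smooth.continuous, hyc, ?_⟩
    refine SmoothOn.congr (SmoothOn.linear (SmoothOn.clAction
      (hγs.mono fun z hz => ⟨hz.1.2, hz.2⟩).spin_inv
      ((h c₀ hc₀).mono fun z hz => ⟨hz.1.1, hz.2⟩) ρ') (R.restrictScalars ℝ)) fun z hz => ?_
    refine (hR z (c.2 z)).trans (congrArg R ?_)
    exact (congrArg (φ z).1 (hγ z ⟨hz.1.2, hz.2⟩)).trans (SpinFrames.spinor_act _ _ _)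
  · intro h c₀ hc₀
    refine smoothOn_of_locally fun y hy => ?_
    obtain ⟨c, hc, hyc⟩ := H.exists_inducedSpin_section hn hP y
    obtain ⟨γ, hγ, hγs⟩ := hc.2 c₀ hc₀
    refine ⟨c.1, c.1.isOpen, hyc, ?_⟩
    refine SmoothOn.congr (SmoothOn.clAction (hγs.mono fun z hz => ⟨hz.2, hz.1.2⟩)
      (((h c hc).mono fun z hz => ⟨hz.1.1, hz.2⟩).linear (S.restrictScalars ℝ)) ρ') fun z hz => ?_
    rw [SpinFrames.spinor_eq_apply_act _ _ (γ z), ← hγ z ⟨hz.2, hz.1.2⟩]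
    exact congrArg _ (hS z (c.2 z))

/-- In the adapted frame `π(p)`, `df(X)` has coordinates `(v, 0)` and `ν` has `eₙ₊₁`, so the product
acts as `v eₙ₊₁`. -/
theorem cliffordMul_push_ν_apply {x : M} (X : TangentSpace (𝓡 n) x) (φ : P.Spinor ρ' (H.f x))
    (q : (H.inducedSpin P).Fiber x) :
    (P.cliffordMul ρ' (H.push X) (P.cliffordMul ρ' (H.ν x) φ)).1 q.1.2
      = ρ' (cclEven n (cvec (q.1.1.toEquiv.symm X))) (φ.1 q.1.2) := by
  have h1 : (P.proj q.1.2).toEquiv.symm (H.push X) = incl n (q.1.1.toEquiv.symm X) := by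
    rw [LinearEquiv.symm_apply_eq, q.2.1, LinearEquiv.apply_symm_apply]
  have h2 : (P.proj q.1.2).toEquiv.symm (H.ν x) = lastVec n := by
    rw [LinearEquiv.symm_apply_eq, q.2.2]
  change ρ' (cvec ((P.proj q.1.2).toEquiv.symm (H.push X)))
    (ρ' (cvec ((P.proj q.1.2).toEquiv.symm (H.ν x))) (φ.1 q.1.2)) = _
  rw [h1, h2, cclEven_cvec, map_mul, Module.End.mul_apply]

theorem exists_spinor_equiv_of_even (hn : 1 ≤ n) (hn' : Even n) (hP : P.IsSpinStructure)
    (hρ : IsSpinorRep ρ) (hρ' : IsSpinorRep ρ') :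
    ∃ Ψ : ∀ x : M, P.Spinor ρ' (H.f x) ≃ₗ[ℂ] (H.inducedSpin P).Spinor ρ x,
      (∀ (U : Opens M) (φ : ∀ x : M, P.Spinor ρ' (H.f x)),
        P.SmoothSpinor (k := n) ρ' H.f U φ ↔
          (H.inducedSpin P).SmoothSpinor (k := n) ρ (fun x : M => x) U (fun x => Ψ x (φ x))) ∧
      ∀ (x : M) (X : TangentSpace (𝓡 n) x) (φ : P.Spinor ρ' (H.f x)),
        (H.inducedSpin P).cliffordMul ρ X (Ψ x φ) =
          Ψ x (P.cliffordMul ρ' (H.push X) (P.cliffordMul ρ' (H.ν x) φ)) := by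
  have hQ := H.isSpinStructure_inducedSpin hn hP
  obtain ⟨T, hT⟩ := (hρ'.comp_cclEven hn').exists_equiv hρ
  simp only [AlgHom.comp_apply] at hT
  -- An arbitrary choice, with no smoothness: by `hΨ` the formula for `Ψ` holds at every point of
  -- the fibre.
  let q : ∀ x : M, (H.inducedSpin P).Fiber x := fun x => (hQ.nonempty_fiber x).some
  let Ψ : ∀ x : M, P.Spinor ρ' (H.f x) ≃ₗ[ℂ] (H.inducedSpin P).Spinor ρ x := fun x =>
    (hP.evalEquiv ρ' (q x).1.2).trans (T.trans (hQ.evalEquiv ρ (q x)).symm)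
  have hΨ₀ : ∀ x φ, (Ψ x φ).1 (q x) = T (φ.1 (q x).1.2) := fun x φ =>
    (hQ.evalEquiv ρ (q x)).apply_symm_apply _
  have hΨ : ∀ x φ q', (Ψ x φ).1 q' = T (φ.1 q'.1.2) := fun x φ =>
    H.apply_eq_of_apply_eq hn hP (R := T.toLinearMap) (fun p a => hT a _) (hΨ₀ x φ)
  refine ⟨Ψ, fun U φ => ?_, fun x X φ => ?_⟩
  · refine H.smoothSpinor_iff hn hP (R := T.toLinearMap) (S := T.symm.toLinearMap)
      (fun x q => hΨ x _ q) (fun x q => ?_) U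
    rw [hΨ]
    exact (T.symm_apply_apply _).symm
  · refine hQ.spinor_ext (q x) ?_
    rw [hΨ, cliffordMul_push_ν_apply, hT]
    change ρ (cvec ((q x).1.1.toEquiv.symm X)) ((Ψ x φ).1 (q x)) = _
    rw [hΨ]

theorem exists_posSpinor_equiv_of_odd (hn : 1 ≤ n) (hn' : Odd n) (hP : P.IsSpinStructure)
    (hρ : IsSpinorRep ρ) (hρ' : IsSpinorRep ρ') :
    ∃ Ψ : ∀ x : M, P.PosSpinor ρ' (H.f x) ≃ₗ[ℂ] (H.inducedSpin P).Spinor ρ x,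
      (∀ (U : Opens M) (φ : ∀ x : M, P.PosSpinor ρ' (H.f x)),
        P.SmoothSpinor (k := n) ρ' H.f U (fun x => (φ x : P.Spinor ρ' (H.f x))) ↔
          (H.inducedSpin P).SmoothSpinor (k := n) ρ (fun x : M => x) U (fun x => Ψ x (φ x))) ∧
      ∀ (x : M) (X : TangentSpace (𝓡 n) x) (φ : P.PosSpinor ρ' (H.f x)),
        ∃ h : P.cliffordMul ρ' (H.push X) (P.cliffordMul ρ' (H.ν x) φ) ∈
            P.PosSpinor ρ' (H.f x),
          (H.inducedSpin P).cliffordMul ρ X (Ψ x φ) =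
            Ψ x ⟨P.cliffordMul ρ' (H.push X) (P.cliffordMul ρ' (H.ν x) φ), h⟩ := by
  have hQ := H.isSpinStructure_inducedSpin hn hP
  obtain ⟨T, hT⟩ := (hρ'.posRep hn').exists_equiv hρ
  -- `T` lives only on the positive eigenspace. An arbitrary linear extension to `W'` suffices,
  -- since positive spinors take their values in that eigenspace.
  obtain ⟨R, hRT⟩ := LinearMap.exists_extend T.toLinearMap
  have hR : ∀ w (hw : w ∈ posSubmodule ρ'), R w = T ⟨w, hw⟩ := fun w hw =>
    LinearMap.congr_fun hRT ⟨w, hw⟩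
  let q : ∀ x : M, (H.inducedSpin P).Fiber x := fun x => (hQ.nonempty_fiber x).some
  let Ψ : ∀ x : M, P.PosSpinor ρ' (H.f x) ≃ₗ[ℂ] (H.inducedSpin P).Spinor ρ x := fun x =>
    (hP.evalPosEquiv hn'.add_one ρ' (q x).1.2).trans (T.trans (hQ.evalEquiv ρ (q x)).symm)
  have hΨ₀ : ∀ x φ, (Ψ x φ).1 (q x) = R (φ.1.1 (q x).1.2) := fun x φ =>
    ((hQ.evalEquiv ρ (q x)).apply_symm_apply _).trans (hR _ (φ.2 _)).symm
  have hRρ : ∀ w ∈ posSubmodule ρ', ∀ a, R (ρ' (cclEven n a) w) = ρ a (R w) := fun w hw a => by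
    rw [hR w hw, hR _ (cclEven_apply_mem_posSubmodule hn' a hw), ← hT]
    rfl
  have hΨ : ∀ x φ q', (Ψ x φ).1 q' = R (φ.1.1 q'.1.2) := fun x φ =>
    H.apply_eq_of_apply_eq hn hP (fun p a => hRρ _ (φ.2 p) a) (hΨ₀ x φ)
  refine ⟨Ψ, fun U φ => ?_, fun x X φ => ⟨?_, ?_⟩⟩
  · refine H.smoothSpinor_iff hn hP (R := R) (S := (posSubmodule ρ').subtype ∘ₗ T.symm.toLinearMap)
      (fun x q => hΨ x _ q) (fun x q => ?_) U
    rw [hΨ, hR _ ((φ x).2 _)]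
    exact congrArg Subtype.val (T.symm_apply_apply ⟨_, (φ x).2 q.1.2⟩).symm
  · rw [hP.mem_posSpinor_iff hn'.add_one (q x).1.2, cliffordMul_push_ν_apply]
    exact cclEven_apply_mem_posSubmodule hn' _ (φ.2 _)
  · refine hQ.spinor_ext (q x) ?_
    rw [hΨ, cliffordMul_push_ν_apply, hRρ _ (φ.2 _)]
    change ρ (cvec ((q x).1.1.toEquiv.symm X)) ((Ψ x φ).1 (q x)) = _
    rw [hΨ]

end Spinors

end OrientedHypersurface

end SpinGeom

end

theorem mainTheorem7 {n : ℕ} (hn : 1 ≤ n)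
    {M : Type*} [TopologicalSpace M] [ChartedSpace (Eucl n) M] [IsManifold (𝓡 n) ∞ M]
    {N : Type*} [TopologicalSpace N] [ChartedSpace (Eucl (n + 1)) N]
    [IsManifold (𝓡 (n + 1)) ∞ N]
    {GM : OrientedRiemannian n M} {GN : OrientedRiemannian (n + 1) N}
    (H : OrientedHypersurface GM GN)
    (P : SpinFrames GN) (hP : P.IsSpinStructure)
    {W : Type*} [AddCommGroup W] [Module ℂ W] [FiniteDimensional ℂ W]
    (ρ : CCl n →ₐ[ℂ] Module.End ℂ W) (hρ : IsSpinorRep ρ)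
    {W' : Type*} [AddCommGroup W'] [Module ℂ W'] [FiniteDimensional ℂ W']
    (ρ' : CCl (n + 1) →ₐ[ℂ] Module.End ℂ W') (hρ' : IsSpinorRep ρ') :
    (H.inducedSpin P).IsSpinStructure ∧
    (Even n →
      ∃ Ψ : ∀ x : M, P.Spinor ρ' (H.f x) ≃ₗ[ℂ] (H.inducedSpin P).Spinor ρ x,
        (∀ (U : Opens M) (φ : ∀ x : M, P.Spinor ρ' (H.f x)),
          P.SmoothSpinor (k := n) ρ' H.f U φ ↔
            (H.inducedSpin P).SmoothSpinor (k := n) ρ (fun x : M => x) U (fun x => Ψ x (φ x))) ∧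
        ∀ (x : M) (X : TangentSpace (𝓡 n) x) (φ : P.Spinor ρ' (H.f x)),
          (H.inducedSpin P).cliffordMul ρ X (Ψ x φ) =
            Ψ x (P.cliffordMul ρ' (H.push X) (P.cliffordMul ρ' (H.ν x) φ))) ∧
    (Odd n →
      ∃ Ψ : ∀ x : M, P.PosSpinor ρ' (H.f x) ≃ₗ[ℂ] (H.inducedSpin P).Spinor ρ x,
        (∀ (U : Opens M) (φ : ∀ x : M, P.PosSpinor ρ' (H.f x)),
          P.SmoothSpinor (k := n) ρ' H.f U (fun x => (φ x : P.Spinor ρ' (H.f x))) ↔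
            (H.inducedSpin P).SmoothSpinor (k := n) ρ (fun x : M => x) U (fun x => Ψ x (φ x))) ∧
        ∀ (x : M) (X : TangentSpace (𝓡 n) x) (φ : P.PosSpinor ρ' (H.f x)),
          ∃ h : P.cliffordMul ρ' (H.push X) (P.cliffordMul ρ' (H.ν x) φ) ∈
              P.PosSpinor ρ' (H.f x),
            (H.inducedSpin P).cliffordMul ρ X (Ψ x φ) =
              Ψ x ⟨P.cliffordMul ρ' (H.push X) (P.cliffordMul ρ' (H.ν x) φ), h⟩) := by
  exact ⟨H.isSpinStructure_inducedSpin hn hP,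
    fun h => H.exists_spinor_equiv_of_even hn h hP hρ hρ',
    fun h => H.exists_posSpinor_equiv_of_odd hn h hP hρ hρ'⟩
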